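/- Let $l_1,l_2,l_3\in\mathbb R^3$ be linearly independent lattice vectors, $L_n=n_1l_1+n_2l_2+n_3l_3$ for $n\in\mathbb Z^3$, let $V$ be the volume of the unit cell spanned by $l_1,l_2,l_3$, let $k_t=2\pi\,(l_{t+1}\times l_{t+2})/(l_t\cdot(l_{t+1}\times l_{t+2}))$ (indices modulo $3$) and $G_m=m_1k_1+m_2k_2+m_3k_3$ for $m\in\mathbb Z^3$. Let $\alpha>0$, $k_e\in\mathbb R$, and let $q_1,\dots,q_N\in\mathbb R$ be charges at positions $r_1,\dots,r_N\in\mathbb R^3$; write $r_{i,j}=r_i-r_j$ and $r_{i,j,n}=r_i+L_n-r_j$. Here $\operatorname{erf}(z)=\frac2{\sqrt\pi}\int_0^z e^{-t^2}\,dt$, and $\operatorname{erf}(\alpha\rho)/\rho$ stands for its limit $2\alpha/\sqrt\pi$ at $\rho=0$. The long-range (erf-screened) Coulomb energy $$\Phi^L=\frac{k_e}2\sum_{n\in\mathbb Z^3}\sum_{i,j=1}^N q_iq_j\,\frac{\operatorname{erf}(\alpha\|r_{i,j,n}\|)}{\|r_{i,j,n}\|}$$ and the lattice function $f(r)=\sum_{n}\operatorname{erf}(\alpha\|r+L_n\|)/\|r+L_n\|$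 are not absolutely convergent in general. They are understood through a convergence factor on the pair distance: for $\kappa>0$ put $$f_\kappa(r)=\sum_{n\in\mathbb Z^3}\frac{\operatorname{erf}(\alpha\|r+L_n\|)}{\|r+L_n\|}e^{-\kappa\|r+L_n\|^2},\qquad \Phi^L_\kappa=\frac{k_e}2\sum_{n\in\mathbb Z^3}\sum_{i,j=1}^N q_iq_j\,\frac{\operatorname{erf}(\alpha\|r_{i,j,n}\|)}{\|r_{i,j,n}\|}e^{-\kappa\|r_{i,j,n}\|^2},$$ $$h_\kappa(m)=\frac1V\int_{\mathrm{cell}}f_\kappa(r)e^{-iG_m\cdot r}\,dr,\qquad h(m)=\frac{4\pi}{V\|G_m\|^2}\exp\Bigl(-\frac{\|G_m\|^2}{4\alpha^2}\Bigr)\quad(m\ne0).$$ Then: 1. For every $\kappa>0$ the series for $f_\kappa(r)$ converges absolutely for every $r$, $f_\kappa$ is continuous and $f_\kappa(r+L_n)=f_\kappa(r)$ for all $n\in\mathbb Z^3$, and $f_\kappa(r)=\sum_{m\in\mathbb Z^3}h_\kappa(m)e^{iG_m\cdot r}$ for every $r$ with absolute convergence. 2. $\lim_{\kappa\to0^+}h_\kappa(m)=h(m)$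 for every $m\ne0$. 3. For every $r$ the series $\sum_{m\neq0}h(m)e^{iG_m\cdot r}$ converges absolutely and $\lim_{\kappa\to0^+}\bigl(f_\kappa(r)-h_\kappa(0)\bigr)=\sum_{m\ne0}h(m)e^{iG_m\cdot r}$. 4. The reciprocal-lattice series $$\Phi^L_{\mathrm{rec}}=\frac{k_e}{2}\sum_{m\neq0}\sum_{i=1}^N\sum_{j=1}^N q_iq_j\,\frac{4\pi}{V\|G_m\|^2}\exp\Bigl(-\frac{\|G_m\|^2}{4\alpha^2}\Bigr)\exp(iG_m\cdot r_{i,j})$$ converges absolutely in $m$, and, with the zero mode removed, the long-range energy equals it: $\lim_{\kappa\to0^+}\bigl(\Phi^L_\kappa-\tfrac{k_e}2(\sum_iq_i)^2h_\kappa(0)\bigr)=\Phi^L_{\mathrm{rec}}$. 5. If $\sum_iq_i=0$, then $\lim_{\kappa\to0^+}\Phi^L_\kappa=\Phi^L_{\mathrm{rec}}$. 6. If $\sum_iq_i=0$ and $\sum_iq_ir_i=0$, then the plain sum over $n$ defining $\Phi^L$ converges absolutely and $\Phi^L=\Phi^L_{\mathrm{rec}}$. -/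

import Mathlib

open Filter Topology MeasureTheory

noncomputable section

namespace Ewald

/-- Three-dimensional Euclidean space. -/
abbrev E3 : Type := EuclideanSpace ℝ (Fin 3)

/-- The error function `erf z = (2 / √π) ∫₀ᶻ exp (-t²) dt`. -/
def erf (z : ℝ) : ℝ := 2 / Real.sqrt Real.pi * ∫ t in (0 : ℝ)..z, Real.exp (-t ^ 2)

/-- The screened Coulomb kernel `erf (α ρ) / ρ` as a function of the distance `ρ`, with its limit
`2 α / √π` at `ρ = 0` (the value used for the pair `i = j` in the central cell). -/
def screened (α ρ : ℝ) : ℝ :=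
  if ρ = 0 then 2 * α / Real.sqrt Real.pi else erf (α * ρ) / ρ

/-- The cross product on Euclidean space. -/
def cross (a b : E3) : E3 := WithLp.toLp 2 (crossProduct (WithLp.ofLp a) (WithLp.ofLp b))

/-- The lattice translation `L_n = n₁ l₁ + n₂ l₂ + n₃ l₃`. -/
def latticeVec (L : Fin 3 → E3) (n : Fin 3 → ℤ) : E3 := ∑ t, (n t : ℝ) • L t

/-- The reciprocal basis `k_t = 2π (l_{t+1} × l_{t+2}) / (l_t · (l_{t+1} × l_{t+2}))`, with
indices modulo 3. -/
def recipBasis (L : Fin 3 → E3) (t : Fin 3) : E3 :=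
  (2 * Real.pi / inner ℝ (L t) (cross (L (t + 1)) (L (t + 2)))) • cross (L (t + 1)) (L (t + 2))

/-- The reciprocal lattice vector `G_m = m₁ k₁ + m₂ k₂ + m₃ k₃`. -/
def recipVec (L : Fin 3 → E3) (m : Fin 3 → ℤ) : E3 := ∑ t, (m t : ℝ) • recipBasis L t

/-- The volume `V` of the unit cell spanned by `l₁, l₂, l₃`. -/
def cellVolume (L : Fin 3 → E3) : ℝ := (volume (parallelepiped L)).toReal

/-- The plane wave `exp (i G_m · r)`. -/
def planeWave (L : Fin 3 → E3) (m : Fin 3 → ℤ) (r : E3) : ℂ :=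
  Complex.exp (Complex.I * ((inner ℝ (recipVec L m) r : ℝ) : ℂ))

/-- The reciprocal-space coefficient `4π / (V ‖G_m‖²) * exp (-‖G_m‖² / (4 α²))`, for `m ≠ 0`. -/
def recipCoeff (α : ℝ) (L : Fin 3 → E3) (m : Fin 3 → ℤ) : ℝ :=
  4 * Real.pi / (cellVolume L * ‖recipVec L m‖ ^ 2) *
    Real.exp (-‖recipVec L m‖ ^ 2 / (4 * α ^ 2))

/-- One summand of the lattice sum at `r`, with convergence factor `exp (-κ ‖r + L_n‖²)`. -/
def dampedTerm (α κ : ℝ) (L : Fin 3 → E3) (r : E3) (n : Fin 3 → ℤ) : ℝ :=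
  screened α ‖r + latticeVec L n‖ * Real.exp (-κ * ‖r + latticeVec L n‖ ^ 2)

/-- The lattice-periodic function `∑_n erf (α ‖r + L_n‖) / ‖r + L_n‖`, summed with the convergence
factor `exp (-κ ‖r + L_n‖²)`. -/
def dampedLattice (α κ : ℝ) (L : Fin 3 → E3) (r : E3) : ℝ :=
  ∑' n : Fin 3 → ℤ, dampedTerm α κ L r n

/-- The Fourier coefficient `(1 / V) ∫_cell f(r) exp (-i G_m · r) dr` of a function `f`. -/
def cellFourierCoeff (L : Fin 3 → E3) (f : E3 → ℝ) (m : Fin 3 → ℤ) : ℂ :=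
  (1 / (cellVolume L : ℂ)) *
    ∫ r in parallelepiped L,
      (f r : ℂ) * Complex.exp (-(Complex.I * ((inner ℝ (recipVec L m) r : ℝ) : ℂ)))

/-- The contribution of the image `n` to the long-range energy without the factor `k_e / 2`:
`∑_{i,j} q_i q_j erf (α ‖r_{i,j,n}‖) / ‖r_{i,j,n}‖`, where `r_{i,j,n} = r_i + L_n - r_j`. -/
def longRangeTerm {N : ℕ} (α : ℝ) (L : Fin 3 → E3) (q : Fin N → ℝ) (R : Fin N → E3)
    (n : Fin 3 → ℤ) : ℝ :=
  ∑ i, ∑ j, q i * q j * screened α ‖R i + latticeVec L n - R j‖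

/-- The plain lattice sum for the long-range energy `Φ^L`. -/
def longRangeEnergy {N : ℕ} (ke α : ℝ) (L : Fin 3 → E3) (q : Fin N → ℝ) (R : Fin N → E3) : ℝ :=
  ke / 2 * ∑' n : Fin 3 → ℤ, longRangeTerm α L q R n

/-- The lattice sum for the long-range energy, with convergence factor
`exp (-κ ‖r_{i,j,n}‖²)` on each pair interaction. -/
def dampedEnergy {N : ℕ} (ke α κ : ℝ) (L : Fin 3 → E3) (q : Fin N → ℝ) (R : Fin N → E3) : ℝ :=
  ke / 2 * ∑' n : Fin 3 → ℤ, ∑ i, ∑ j,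
    q i * q j * (screened α ‖R i + latticeVec L n - R j‖ *
      Real.exp (-κ * ‖R i + latticeVec L n - R j‖ ^ 2))

/-- The summand of the reciprocal-space energy at `m`. -/
def recipTerm {N : ℕ} (ke α : ℝ) (L : Fin 3 → E3) (q : Fin N → ℝ) (R : Fin N → E3)
    (m : Fin 3 → ℤ) : ℂ :=
  ∑ i, ∑ j, ((ke / 2 * (q i * q j) * recipCoeff α L m : ℝ) : ℂ) * planeWave L m (R i - R j)

/-- The reciprocal-space energy, summed over all integer triples `m ≠ (0, 0, 0)`. -/
def recipEnergy {N : ℕ} (ke α : ℝ) (L : Fin 3 → E3) (q : Fin N → ℝ) (R : Fin N → E3) : ℂ :=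
  ∑' m : {m : Fin 3 → ℤ // m ≠ 0}, recipTerm ke α L q R m

end Ewald

end

open Ewald

/-!
The screened kernel is a mixture of Gaussians,
`erf (α ρ) / ρ = (2 / √π) ∫ t in 0..α, exp (-t² ρ²)` (`screened_eq_integral`, valid also at
`ρ = 0`), and the convergence factor only replaces `t²` by `t² + κ`. Everything is read off from
this formula.

* *Poisson summation.* The damped lattice sum is the periodization of an integrable continuous
  function, so its Fourier coefficients over the unit cell are, up to the factor `1 / V`, the
  Fourier transform of that function at the reciprocal lattice points
  (`setIntegral_parallelepiped_tsum`). By Fubini the transform is the mixture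
  `(2 / √π) ∫ t in 0..α, (π / s)^(3/2) exp (-k² / (4 s))` with `s = t² + κ` (`kernelTransform`,
  `cellFourierCoeff_dampedLattice`). The bound `exp (-x) ≤ 2 / x²` makes it `O(k⁻⁴)` uniformly for
  bounded `κ`, which is summable over a three-dimensional lattice. Hence the Fourier series
  converges absolutely to the damped lattice sum (`hasSum_dampedLattice`), by transport to the
  unit torus (`hasSum_cellFourierCoeff`).

* *Removing the damping.* For `k ≠ 0` the mixture at `κ = 0` is elementary and equals
  `4 π / k² * exp (-k² / (4 α²))` (`kernelTransform_zero`). The uniform `O(k⁻⁴)` bound allows the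
  limit `κ → 0` to be taken term by term in the Fourier series without its zero mode
  (`tendsto_dampedLattice_sub`). The energies are finite combinations of values of the lattice
  function, in which the zero mode carries the factor `(∑ i, q i)²` (`tendsto_dampedEnergy_sub`).

* *Cells without charge and dipole moment.* The double sum over the charges annihilates the
  second-order Taylor polynomial of the pair interaction with a fixed image, a polynomial of
  degree two in `r_i - r_j` (`sum_charge_mul_taylor_eq_zero`). Expanding each Gaussian to second
  order and integrating the third-order remainder over `t` bounds the interaction with the image
  at `v` by `C ‖v‖⁻⁴`, uniformly in `κ` (`abs_imageEnergy_le_of_dipole`). So the plain sum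
  converges absolutely, and by dominated convergence it is the limit of the damped energies, which
  has already been identified.
-/

namespace Ewald

/-! ### The screened kernel as a mixture of Gaussians -/

lemma screened_eq_integral (α ρ : ℝ) :
    screened α ρ = 2 / √Real.pi * ∫ t in (0 : ℝ)..α, Real.exp (-t ^ 2 * ρ ^ 2) := by
  unfold screened erf
  split_ifs with h
  · subst h
    simp
    ring
  · have := intervalIntegral.integral_comp_mul_right (a := 0) (b := α)
      (fun t => Real.exp (-t ^ 2)) h
    simp only [smul_eq_mul, zero_mul] at this
    rw [mul_div_assoc, div_eq_inv_mul (∫ t in (0 : ℝ)..α * ρ, _) ρ, ← this]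
    congr 2
    ext t
    ring_nf

/-- The screened Coulomb kernel with its Gaussian convergence factor, as a function on space. -/
noncomputable def dampedKernel (α κ : ℝ) (x : E3) : ℝ :=
  screened α ‖x‖ * Real.exp (-κ * ‖x‖ ^ 2)

lemma dampedKernel_eq_integral (α κ : ℝ) (x : E3) :
    dampedKernel α κ x
      = 2 / √Real.pi * ∫ t in (0 : ℝ)..α, Real.exp (-(t ^ 2 + κ) * ‖x‖ ^ 2) := by
  rw [dampedKernel, screened_eq_integral, mul_assoc, ← intervalIntegral.integral_mul_const]
  congr 2
  ext t
  rw [← Real.exp_add]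
  ring_nf

lemma continuous_dampedKernel (α κ : ℝ) : Continuous (dampedKernel α κ) := by
  have : dampedKernel α κ
      = fun x => 2 / √Real.pi * ∫ t in (0 : ℝ)..α, Real.exp (-(t ^ 2 + κ) * ‖x‖ ^ 2) :=
    funext (dampedKernel_eq_integral α κ)
  rw [this]
  refine continuous_const.mul
    (intervalIntegral.continuous_parametric_intervalIntegral_of_continuous' ?_ 0 α)
  simp only [Function.uncurry_def]
  fun_prop

lemma screened_nonneg {α : ℝ} (hα : 0 ≤ α) (ρ : ℝ) : 0 ≤ screened α ρ := by
  rw [screened_eq_integral]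
  have := intervalIntegral.integral_nonneg (f := fun t => Real.exp (-t ^ 2 * ρ ^ 2)) hα
    (fun t _ => (Real.exp_pos _).le) (μ := volume)
  positivity

lemma screened_le {α : ℝ} (hα : 0 ≤ α) (ρ : ℝ) : screened α ρ ≤ 2 / √Real.pi * α := by
  rw [screened_eq_integral]
  gcongr
  have : ∫ t in (0 : ℝ)..α, Real.exp (-t ^ 2 * ρ ^ 2) ≤ ∫ t in (0 : ℝ)..α, (1 : ℝ) := by
    apply intervalIntegral.integral_mono_on hα
    · exact (by fun_prop : Continuous fun t : ℝ => Real.exp (-t ^ 2 * ρ ^ 2)).intervalIntegrable _ _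
    · simp
    · intro t _
      rw [Real.exp_le_one_iff]
      nlinarith [mul_nonneg (sq_nonneg t) (sq_nonneg ρ)]
  simpa using this

lemma dampedKernel_nonneg {α : ℝ} (hα : 0 ≤ α) (κ : ℝ) (x : E3) : 0 ≤ dampedKernel α κ x :=
  mul_nonneg (screened_nonneg hα _) (Real.exp_pos _).le

lemma dampedKernel_le {α : ℝ} (hα : 0 ≤ α) (κ : ℝ) (x : E3) :
    dampedKernel α κ x ≤ 2 / √Real.pi * α * Real.exp (-κ * ‖x‖ ^ 2) := by
  unfold dampedKernel
  gcongr
  exact screened_le hα _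

lemma integrable_gaussian {κ : ℝ} (hκ : 0 < κ) :
    Integrable (fun x : E3 => Real.exp (-κ * ‖x‖ ^ 2)) := by
  have := (GaussianFourier.integrable_cexp_neg_mul_sq_norm_add (V := E3) (b := (κ : ℂ))
    (by simpa using hκ) 0 0).norm
  refine this.congr (Eventually.of_forall fun x => ?_)
  simp only [Complex.norm_exp]
  congr 1
  simp [← Complex.ofReal_pow, ← Complex.ofReal_mul]

lemma integrable_dampedKernel {α κ : ℝ} (hα : 0 ≤ α) (hκ : 0 < κ) :
    Integrable (dampedKernel α κ) := by
  refine ((integrable_gaussian hκ).const_mul (2 / √Real.pi * α)).mono'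
    (continuous_dampedKernel α κ).aestronglyMeasurable (Eventually.of_forall fun x => ?_)
  rw [Real.norm_of_nonneg (dampedKernel_nonneg hα κ x)]
  exact dampedKernel_le hα κ x

/-! ### The Fourier transform of the damped kernel -/

/-- The Fourier transform on three-dimensional space of the Gaussian `exp (-s ‖x‖²)`, at a
frequency of length `k`. -/
noncomputable def gaussTransform (s k : ℝ) : ℝ :=
  (Real.pi / s) ^ (3 / 2 : ℝ) * Real.exp (-k ^ 2 / (4 * s))

lemma integral_gaussian_mul_cexp {s : ℝ} (hs : 0 < s) (G : E3) :
    ∫ x : E3, (Real.exp (-s * ‖x‖ ^ 2) : ℂ) * Complex.exp (-(Complex.I * (inner ℝ G x : ℝ)))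
      = (gaussTransform s ‖G‖ : ℂ) := by
  have h := GaussianFourier.integral_cexp_neg_mul_sq_norm_add (V := E3) (b := (s : ℂ))
    (by simpa using hs) (-Complex.I) G
  calc _ = ∫ v : E3, Complex.exp (-(s : ℂ) * ‖v‖ ^ 2 + -Complex.I * (inner ℝ G v : ℝ)) := by
        congr 1
        ext v
        rw [Complex.exp_add]
        push_cast
        ring_nf
    _ = _ := by
        rw [h, gaussTransform, Complex.ofReal_mul, Complex.ofReal_cpow (by positivity)]
        simp only [finrank_euclideanSpace, Fintype.card_fin]
        push_cast
        simp

/-- The Fourier transform of the damped kernel at a frequency of length `k`. -/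
noncomputable def kernelTransform (α κ k : ℝ) : ℝ :=
  2 / √Real.pi * ∫ t in (0 : ℝ)..α, gaussTransform (t ^ 2 + κ) k

/-- The Gaussian mixture and the Fourier integral may be interchanged because the damping gives the
integrable majorant `exp (-κ ‖x‖²)`. -/
lemma integral_dampedKernel_mul_cexp {α κ : ℝ} (hα : 0 ≤ α) (hκ : 0 < κ) (G : E3) :
    ∫ x : E3, (dampedKernel α κ x : ℂ) * Complex.exp (-(Complex.I * (inner ℝ G x : ℝ)))
      = (kernelTransform α κ ‖G‖ : ℂ) := by
  have hint : Integrable (Function.uncurry fun (x : E3) (t : ℝ) =>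
      (Real.exp (-(t ^ 2 + κ) * ‖x‖ ^ 2) : ℂ) * Complex.exp (-(Complex.I * (inner ℝ G x : ℝ))))
      (volume.prod (volume.restrict (Set.Ioc 0 α))) := by
    have h1 : Integrable (fun z : E3 × ℝ => Real.exp (-κ * ‖z.1‖ ^ 2) * 1)
        (volume.prod (volume.restrict (Set.Ioc 0 α))) :=
      (integrable_gaussian hκ).mul_prod (integrable_const (1 : ℝ))
    refine h1.mono' ?_ (Eventually.of_forall fun z => ?_)
    · apply Continuous.aestronglyMeasurable
      simp only [Function.uncurry_def]
      fun_prop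
    · simp only [Function.uncurry_def, norm_mul, Complex.norm_real, Real.norm_eq_abs, Real.abs_exp,
        Complex.norm_exp]
      simp
      nlinarith [mul_nonneg (sq_nonneg z.2) (sq_nonneg ‖z.1‖)]
  calc _ = ∫ x : E3, (2 / √Real.pi : ℝ) * ∫ t in Set.Ioc 0 α,
          (Real.exp (-(t ^ 2 + κ) * ‖x‖ ^ 2) : ℂ) *
            Complex.exp (-(Complex.I * (inner ℝ G x : ℝ))) := by
        congr 1
        ext x
        rw [dampedKernel_eq_integral, intervalIntegral.integral_of_le hα, integral_mul_const,
          integral_complex_ofReal, Complex.ofReal_mul, mul_assoc]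
    _ = _ := by
        rw [integral_const_mul, integral_integral_swap hint, kernelTransform,
          intervalIntegral.integral_of_le hα, Complex.ofReal_mul, ← integral_complex_ofReal]
        congr 1
        refine setIntegral_congr_fun measurableSet_Ioc fun t _ => ?_
        exact integral_gaussian_mul_cexp (by positivity) G

/-! ### The lattice and its dual -/

/-- The triple product is the determinant of the matrix with rows `L t`. -/
lemma inner_cross_ne_zero {L : Fin 3 → E3} (hL : LinearIndependent ℝ L) :
    inner ℝ (L 0) (cross (L 1) (L 2)) ≠ 0 := by
  have h1 : LinearIndependent ℝ (fun i => WithLp.ofLp (L i)) :=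
    hL.map' (WithLp.linearEquiv 2 ℝ (Fin 3 → ℝ)).toLinearMap (LinearEquiv.ker _)
  have h2 := (Matrix.linearIndependent_rows_iff_isUnit
    (A := Matrix.of fun i => WithLp.ofLp (L i))).1 h1
  rw [Matrix.isUnit_iff_isUnit_det, isUnit_iff_ne_zero, Matrix.det_fin_three] at h2
  intro h
  apply h2
  simp only [PiLp.inner_apply, Fin.sum_univ_three, cross, crossProduct, LinearMap.mk₂_apply,
    RCLike.inner_apply, conj_trivial] at h
  simp at h
  simp only [Matrix.of_apply]
  linarith

/-- The reciprocal basis is `2π` times the dual basis of the lattice. -/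
lemma inner_recipBasis {L : Fin 3 → E3} (hL : LinearIndependent ℝ L) (s t : Fin 3) :
    inner ℝ (recipBasis L s) (L t) = if s = t then 2 * Real.pi else 0 := by
  have hD := inner_cross_ne_zero hL
  have h1 : inner ℝ (L 1) (cross (L 2) (L 0)) = inner ℝ (L 0) (cross (L 1) (L 2)) := by
    simp only [PiLp.inner_apply, Fin.sum_univ_three, cross, crossProduct, LinearMap.mk₂_apply,
      RCLike.inner_apply, conj_trivial]
    simp
    ring
  have h2 : inner ℝ (L 2) (cross (L 0) (L 1)) = inner ℝ (L 0) (cross (L 1) (L 2)) := by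
    simp only [PiLp.inner_apply, Fin.sum_univ_three, cross, crossProduct, LinearMap.mk₂_apply,
      RCLike.inner_apply, conj_trivial]
    simp
    ring
  have ha : ∀ a b : E3, inner ℝ a (cross a b) = 0 := fun a b => by
    simp only [PiLp.inner_apply, Fin.sum_univ_three, cross, crossProduct, LinearMap.mk₂_apply,
      RCLike.inner_apply, conj_trivial]
    simp
    ring
  have hb : ∀ a b : E3, inner ℝ b (cross a b) = 0 := fun a b => by
    simp only [PiLp.inner_apply, Fin.sum_univ_three, cross, crossProduct, LinearMap.mk₂_apply,
      RCLike.inner_apply, conj_trivial]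
    simp
    ring
  unfold recipBasis
  rw [real_inner_smul_left, real_inner_comm (L t)]
  fin_cases s <;> fin_cases t <;> simp [ha, hb, h1, h2, hD]

lemma linearIndependent_recipBasis {L : Fin 3 → E3} (hL : LinearIndependent ℝ L) :
    LinearIndependent ℝ (recipBasis L) := by
  rw [Fintype.linearIndependent_iff]
  intro c hc t
  have := congrArg (fun v => inner ℝ v (L t)) hc
  simpa [sum_inner, real_inner_smul_left, inner_recipBasis hL, Real.pi_ne_zero] using this

lemma inner_recipVec {L : Fin 3 → E3} (hL : LinearIndependent ℝ L) (m : Fin 3 → ℤ)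
    (x : Fin 3 → ℝ) :
    inner ℝ (recipVec L m) (∑ t, x t • L t) = 2 * Real.pi * ∑ t, (m t : ℝ) * x t := by
  simp only [recipVec, sum_inner, inner_sum, real_inner_smul_left, real_inner_smul_right,
    inner_recipBasis hL, Finset.mul_sum]
  refine Finset.sum_congr rfl fun t _ => ?_
  simp
  ring

lemma inner_recipVec_latticeVec {L : Fin 3 → E3} (hL : LinearIndependent ℝ L) (m n : Fin 3 → ℤ) :
    inner ℝ (recipVec L m) (latticeVec L n) = ((∑ t, m t * n t : ℤ) : ℝ) * (2 * Real.pi) := by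
  rw [latticeVec, inner_recipVec hL m (fun t => (n t : ℝ))]
  push_cast
  ring

lemma planeWave_add (L : Fin 3 → E3) (m : Fin 3 → ℤ) (r s : E3) :
    planeWave L m (r + s) = planeWave L m r * planeWave L m s := by
  simp only [planeWave, inner_add_right, Complex.ofReal_add, mul_add, Complex.exp_add]

lemma planeWave_latticeVec {L : Fin 3 → E3} (hL : LinearIndependent ℝ L) (m n : Fin 3 → ℤ) :
    planeWave L m (latticeVec L n) = 1 := by
  rw [planeWave, inner_recipVec_latticeVec hL, Complex.exp_eq_one_iff]
  exact ⟨∑ t, m t * n t, by push_cast; ring⟩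

lemma norm_planeWave (L : Fin 3 → E3) (m : Fin 3 → ℤ) (r : E3) : ‖planeWave L m r‖ = 1 := by
  rw [planeWave, mul_comm, Complex.norm_exp_ofReal_mul_I]

lemma latticeVec_add (L : Fin 3 → E3) (m n : Fin 3 → ℤ) :
    latticeVec L (m + n) = latticeVec L m + latticeVec L n := by
  simp [latticeVec, add_smul, Finset.sum_add_distrib]

lemma latticeVec_ne_zero {L : Fin 3 → E3} (hL : LinearIndependent ℝ L) {n : Fin 3 → ℤ}
    (hn : n ≠ 0) : latticeVec L n ≠ 0 := by
  intro h
  apply hn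
  ext t
  have := Fintype.linearIndependent_iff.1 hL _ h t
  exact_mod_cast this

/-- The reciprocal lattice is itself the lattice of the reciprocal basis. -/
lemma recipVec_ne_zero {L : Fin 3 → E3} (hL : LinearIndependent ℝ L) {m : Fin 3 → ℤ}
    (hm : m ≠ 0) : recipVec L m ≠ 0 :=
  latticeVec_ne_zero (linearIndependent_recipBasis hL) hm

/-- The basis of space formed by linearly independent lattice vectors. -/
noncomputable def latticeBasis {L : Fin 3 → E3} (hL : LinearIndependent ℝ L) :
    Module.Basis (Fin 3) ℝ E3 :=
  basisOfLinearIndependentOfCardEqFinrank hL (by simp)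

@[simp]
lemma coe_latticeBasis {L : Fin 3 → E3} (hL : LinearIndependent ℝ L) :
    ⇑(latticeBasis hL) = L :=
  coe_basisOfLinearIndependentOfCardEqFinrank _ _

/-- The lattice points are indexed by integer triples. -/
noncomputable def latticeEquiv {L : Fin 3 → E3} (hL : LinearIndependent ℝ L) :
    (Fin 3 → ℤ) ≃ Submodule.span ℤ (Set.range (latticeBasis hL)) :=
  ((latticeBasis hL).restrictScalars ℤ).equivFun.symm.toEquiv

lemma coe_latticeEquiv {L : Fin 3 → E3} (hL : LinearIndependent ℝ L) (n : Fin 3 → ℤ) :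
    (latticeEquiv hL n : E3) = latticeVec L n := by
  simp [latticeEquiv, latticeVec, Module.Basis.equivFun_symm_apply, Int.cast_smul_eq_zsmul]

/-! ### Summability over the lattice -/

lemma summable_inv_norm_latticeVec_pow {L : Fin 3 → E3} (hL : LinearIndependent ℝ L) :
    Summable fun n : Fin 3 → ℤ => ‖latticeVec L n‖⁻¹ ^ 4 := by
  have h := ZLattice.summable_norm_pow_inv
    (Submodule.span ℤ (Set.range (latticeBasis hL))) 4 (by
      rw [Module.finrank_eq_card_basis ((latticeBasis hL).restrictScalars ℤ)]
      simp)
  rw [← (latticeEquiv hL).summable_iff] at h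
  refine h.congr fun n => ?_
  simp [← coe_latticeEquiv hL]

/-- Comparison with the inverse fourth powers. The origin is excluded because the right-hand side is
`0` there by the convention `0⁻¹ = 0`. -/
lemma summable_of_le_inv_norm_latticeVec_pow {L : Fin 3 → E3} (hL : LinearIndependent ℝ L)
    {E : Type*} [NormedAddCommGroup E] [CompleteSpace E] {f : (Fin 3 → ℤ) → E} {C : ℝ}
    (h : ∀ n, n ≠ 0 → ‖f n‖ ≤ C * ‖latticeVec L n‖⁻¹ ^ 4) : Summable f := by
  refine Summable.of_norm_bounded_eventually ((summable_inv_norm_latticeVec_pow hL).mul_left C) ?_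
  refine (Set.finite_singleton (0 : Fin 3 → ℤ)).subset fun n hn => ?_
  by_contra hn0
  exact hn (h n hn0)

lemma exp_neg_le_two_div_sq {x : ℝ} (hx : 0 < x) : Real.exp (-x) ≤ 2 / x ^ 2 := by
  rw [Real.exp_neg, ← one_div, div_le_div_iff₀ (Real.exp_pos _) (by positivity)]
  have := Real.quadratic_le_exp_of_nonneg hx.le
  nlinarith

lemma summable_exp_neg_latticeVec {L : Fin 3 → E3} (hL : LinearIndependent ℝ L) {c : ℝ}
    (hc : 0 < c) : Summable fun n : Fin 3 → ℤ => Real.exp (-(c * ‖latticeVec L n‖ ^ 2)) := by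
  refine summable_of_le_inv_norm_latticeVec_pow hL (C := 2 / c ^ 2) fun n hn => ?_
  have h0 : 0 < ‖latticeVec L n‖ := norm_pos_iff.2 (latticeVec_ne_zero hL hn)
  rw [Real.norm_of_nonneg (Real.exp_pos _).le]
  refine (exp_neg_le_two_div_sq (by positivity)).trans (le_of_eq ?_)
  field_simp

/-- On a bounded set the terms of the damped lattice sum have a summable majorant independent of the
point, since `‖v‖² ≤ 2 ‖r + v‖² + 2 ‖r‖²`. -/
lemma norm_dampedKernel_add_le {α κ : ℝ} (hα : 0 ≤ α) (hκ : 0 < κ) {B : ℝ} {r : E3}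
    (hr : ‖r‖ ≤ B) (v : E3) :
    ‖dampedKernel α κ (r + v)‖
      ≤ 2 / √Real.pi * α * Real.exp (κ * B ^ 2) * Real.exp (-(κ / 2 * ‖v‖ ^ 2)) := by
  rw [Real.norm_of_nonneg (dampedKernel_nonneg hα κ _)]
  refine (dampedKernel_le hα κ _).trans ?_
  rw [mul_assoc _ (Real.exp (κ * B ^ 2)), ← Real.exp_add]
  gcongr
  have h1 : ‖v‖ ≤ ‖r + v‖ + ‖r‖ := by
    simpa using norm_sub_le (r + v) r
  have h2 : ‖v‖ ^ 2 ≤ 2 * ‖r + v‖ ^ 2 + 2 * B ^ 2 := by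
    have : ‖v‖ ^ 2 ≤ (‖r + v‖ + B) ^ 2 := by gcongr; linarith
    nlinarith [sq_nonneg (‖r + v‖ - B)]
  nlinarith

lemma summable_dampedKernel {α κ : ℝ} (hα : 0 ≤ α) (hκ : 0 < κ) {L : Fin 3 → E3}
    (hL : LinearIndependent ℝ L) (r : E3) :
    Summable fun n : Fin 3 → ℤ => dampedKernel α κ (r + latticeVec L n) :=
  Summable.of_norm_bounded ((summable_exp_neg_latticeVec hL (half_pos hκ)).mul_left _)
    fun _ => norm_dampedKernel_add_le hα hκ le_rfl _

lemma dampedLattice_eq_tsum (α κ : ℝ) (L : Fin 3 → E3) (r : E3) :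
    dampedLattice α κ L r = ∑' n : Fin 3 → ℤ, dampedKernel α κ (r + latticeVec L n) := rfl

lemma continuous_dampedLattice {α κ : ℝ} (hα : 0 ≤ α) (hκ : 0 < κ) {L : Fin 3 → E3}
    (hL : LinearIndependent ℝ L) : Continuous (dampedLattice α κ L) := by
  rw [continuous_iff_continuousAt]
  intro r
  have : ContinuousOn (dampedLattice α κ L) (Metric.ball 0 (‖r‖ + 1)) := by
    refine continuousOn_tsum (fun n => ?_)
      ((summable_exp_neg_latticeVec hL (half_pos hκ)).mul_left
        (2 / √Real.pi * α * Real.exp (κ * (‖r‖ + 1) ^ 2))) fun n x hx => ?_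
    · exact ((continuous_dampedKernel α κ).comp (continuous_add_const _)).continuousOn
    · exact norm_dampedKernel_add_le hα hκ (mem_ball_zero_iff.1 hx).le _
  exact this.continuousAt (Metric.isOpen_ball.mem_nhds (by simp))

lemma dampedLattice_add_latticeVec (α κ : ℝ) (L : Fin 3 → E3) (r : E3) (n : Fin 3 → ℤ) :
    dampedLattice α κ L (r + latticeVec L n) = dampedLattice α κ L r := by
  rw [dampedLattice_eq_tsum, dampedLattice_eq_tsum,
    ← (Equiv.addLeft n).tsum_eq (fun m => dampedKernel α κ (r + latticeVec L m))]
  simp [latticeVec_add, add_assoc]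

/-! ### Fourier series of lattice-periodic functions -/

/-- Coordinates with respect to the lattice basis, as a parametrization of space. -/
noncomputable def cellChart {L : Fin 3 → E3} (hL : LinearIndependent ℝ L) :
    (Fin 3 → ℝ) ≃L[ℝ] E3 :=
  (latticeBasis hL).equivFunL.symm

lemma cellChart_apply {L : Fin 3 → E3} (hL : LinearIndependent ℝ L) (x : Fin 3 → ℝ) :
    cellChart hL x = ∑ t, x t • L t := by
  change (latticeBasis hL).equivFun.symm x = _
  simp [Module.Basis.equivFun_symm_apply]

lemma volume_parallelepiped_ne_zero {L : Fin 3 → E3} (hL : LinearIndependent ℝ L) :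
    volume (parallelepiped L) ≠ 0 := by
  have := (latticeBasis hL).parallelepiped.interior_nonempty
  rw [Module.Basis.coe_parallelepiped, coe_latticeBasis] at this
  exact (isOpen_interior.measure_pos volume this).ne' ∘ measure_mono_null interior_subset

lemma isCompact_parallelepiped {L : Fin 3 → E3} (hL : LinearIndependent ℝ L) :
    IsCompact (parallelepiped L) := by
  simpa using (latticeBasis hL).parallelepiped.isCompact

lemma cellVolume_pos {L : Fin 3 → E3} (hL : LinearIndependent ℝ L) : 0 < cellVolume L :=
  ENNReal.toReal_pos (volume_parallelepiped_ne_zero hL) (isCompact_parallelepiped hL).measure_ne_top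

/-- The Lebesgue measure in lattice coordinates. -/
lemma volume_eq_smul_map_cellChart {L : Fin 3 → E3} (hL : LinearIndependent ℝ L) :
    (volume : Measure E3)
      = volume (parallelepiped L) • Measure.map (cellChart hL) volume := by
  have h1 : (Pi.basisFun ℝ (Fin 3)).addHaar = volume := by
    rw [Module.Basis.addHaar_def, Module.Basis.parallelepiped_basisFun, addHaarMeasure_eq_volume_pi]
  have h2 : (Pi.basisFun ℝ (Fin 3)).map (cellChart hL).toLinearEquiv = latticeBasis hL := by
    apply Module.Basis.eq_of_apply_eq
    intro i
    simp [cellChart_apply, Pi.single_apply]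
  rw [← h1, Module.Basis.map_addHaar, h2]
  conv_lhs => rw [Measure.addHaarMeasure_unique (volume : Measure E3)
    (latticeBasis hL).parallelepiped]
  rw [Module.Basis.coe_parallelepiped, coe_latticeBasis, Module.Basis.addHaar_def]

lemma preimage_cellChart_parallelepiped {L : Fin 3 → E3} (hL : LinearIndependent ℝ L) :
    cellChart hL ⁻¹' parallelepiped L = Set.Icc 0 1 := by
  have : parallelepiped L = cellChart hL '' Set.Icc 0 1 := by
    unfold parallelepiped
    refine Set.image_congr fun x _ => (cellChart_apply hL x).symm
  rw [this, Set.preimage_image_eq _ (cellChart hL).injective]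

/-- An integral over the unit cell in lattice coordinates. The coordinate cube is written in the form
in which Fourier coefficients on the unit torus are computed. -/
lemma setIntegral_parallelepiped {L : Fin 3 → E3} (hL : LinearIndependent ℝ L) (f : E3 → ℂ) :
    ∫ r in parallelepiped L, f r
      = cellVolume L * ∫ x in {x : Fin 3 → ℝ | ∀ i, x i ∈ Set.Ioc (0 : ℝ) (0 + 1)},
          f (cellChart hL x) := by
  conv_lhs => rw [volume_eq_smul_map_cellChart hL]
  rw [Measure.restrict_smul, integral_smul_measure,
    (cellChart hL).toHomeomorph.measurableEmbedding.setIntegral_map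
      (f := cellChart hL) (μ := volume) f (parallelepiped L),
    preimage_cellChart_parallelepiped, Complex.real_smul, cellVolume]
  congr 1
  refine setIntegral_congr_set ?_
  have h := (Measure.univ_pi_Ioc_ae_eq_Icc (μ := fun _ : Fin 3 => (volume : Measure ℝ))
    (f := fun _ => (0 : ℝ)) (g := fun _ => 1)).symm
  have hset : {x : Fin 3 → ℝ | ∀ i, x i ∈ Set.Ioc (0 : ℝ) (0 + 1)}
      = Set.univ.pi fun _ => Set.Ioc 0 1 := by
    ext x
    simp [Set.mem_pi]
  rw [hset]
  exact h

/-- The projection from lattice coordinates to the unit torus. -/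
lemma isOpenQuotientMap_torus :
    IsOpenQuotientMap (Pi.map fun (_ : Fin 3) (x : ℝ) => (x : UnitAddCircle)) :=
  IsOpenQuotientMap.piMap fun _ => QuotientAddGroup.isOpenQuotientMap_mk

lemma mFourier_coe {L : Fin 3 → E3} (hL : LinearIndependent ℝ L) (m : Fin 3 → ℤ)
    (x : Fin 3 → ℝ) :
    UnitAddTorus.mFourier m (fun i => (x i : UnitAddCircle))
      = planeWave L m (cellChart hL x) := by
  simp only [UnitAddTorus.mFourier, ContinuousMap.coe_mk, fourier_coe_apply]
  rw [← Complex.exp_sum, planeWave, cellChart_apply, inner_recipVec hL]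
  congr 1
  push_cast
  rw [Finset.mul_sum, Finset.mul_sum]
  refine Finset.sum_congr rfl fun t _ => ?_
  simp
  ring

lemma planeWave_neg (L : Fin 3 → E3) (m : Fin 3 → ℤ) (r : E3) :
    planeWave L (-m) r = Complex.exp (-(Complex.I * ((inner ℝ (recipVec L m) r : ℝ) : ℂ))) := by
  have : recipVec L (-m) = -recipVec L m := by simp [recipVec]
  simp [planeWave, this]

/-- A continuous lattice-periodic function with summable Fourier coefficients is the sum of its
Fourier series. In lattice coordinates this is the statement for the unit torus. -/
theorem hasSum_cellFourierCoeff {L : Fin 3 → E3} (hL : LinearIndependent ℝ L) {f : E3 → ℝ}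
    (hf : Continuous f) (hper : ∀ (r : E3) (n : Fin 3 → ℤ), f (r + latticeVec L n) = f r)
    (hsum : Summable fun m => cellFourierCoeff L f m) (r : E3) :
    HasSum (fun m : Fin 3 → ℤ => cellFourierCoeff L f m * planeWave L m r) (f r : ℂ) := by
  -- Periodicity makes `f`, read in lattice coordinates, factor through the torus.
  let p : C(Fin 3 → ℝ, UnitAddTorus (Fin 3)) :=
    ⟨Pi.map fun _ x => (x : UnitAddCircle), isOpenQuotientMap_torus.continuous⟩
  have hp : IsQuotientMap p := isOpenQuotientMap_torus.isQuotientMap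
  let g : C(Fin 3 → ℝ, ℂ) := ⟨fun x => (f (cellChart hL x) : ℂ), by fun_prop⟩
  have hg : Function.FactorsThrough g p := by
    intro x y hxy
    have h1 : ∀ i, ∃ n : ℤ, x i = y i + n := fun i => by
      have h : ((x i - y i : ℝ) : UnitAddCircle) = 0 := by
        rw [AddCircle.coe_sub, sub_eq_zero]
        exact congrFun hxy i
      obtain ⟨n, hn⟩ := (AddCircle.coe_eq_zero_iff (1 : ℝ)).1 h
      exact ⟨n, by simp at hn; linarith⟩
    choose n hn using h1
    have h2 : cellChart hL x = cellChart hL y + latticeVec L n := by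
      simp [cellChart_apply, latticeVec, hn, add_smul, Finset.sum_add_distrib]
    simp [g, h2, hper]
  let F : C(UnitAddTorus (Fin 3), ℂ) := hp.lift g hg
  have hF : ∀ x : Fin 3 → ℝ, F (fun i => (x i : UnitAddCircle)) = f (cellChart hL x) := fun x =>
    DFunLike.congr_fun (hp.lift_comp g hg) x
  have hcoeff : ∀ m, UnitAddTorus.mFourierCoeff F m = cellFourierCoeff L f m := by
    intro m
    have hV : (cellVolume L : ℂ) ≠ 0 := by exact_mod_cast (cellVolume_pos hL).ne'
    rw [UnitAddTorus.mFourierCoeff_eq_integral _ _ (fun _ => 0), cellFourierCoeff,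
      setIntegral_parallelepiped hL, ← mul_assoc, one_div, inv_mul_cancel₀ hV, one_mul]
    congr 1
    ext x
    rw [mFourier_coe hL, hF, planeWave_neg, smul_eq_mul, mul_comm]
  have hs : Summable (UnitAddTorus.mFourierCoeff F) := hsum.congr fun m => (hcoeff m).symm
  obtain ⟨x, rfl⟩ := (cellChart hL).surjective r
  have := UnitAddTorus.hasSum_mFourier_series_apply_of_summable hs
    (fun i => (x i : UnitAddCircle))
  simpa only [hF, hcoeff, mFourier_coe hL, smul_eq_mul] using this

/-! ### Unfolding -/

/-- Integrating the periodization of a function over the unit cell gives its integral over all of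
space, since the translates of the cell tile space up to a null set. -/
theorem setIntegral_parallelepiped_tsum {L : Fin 3 → E3} (hL : LinearIndependent ℝ L) {g : E3 → ℂ}
    (hg : Integrable g) :
    ∫ r in parallelepiped L, ∑' n : Fin 3 → ℤ, g (r + latticeVec L n) = ∫ r, g r := by
  have hfd := ZSpan.isAddFundamentalDomain (latticeBasis hL) (volume : Measure E3)
  have hae := ZSpan.fundamentalDomain_ae_parallelepiped (latticeBasis hL) (volume : Measure E3)
  rw [coe_latticeBasis] at hae
  have key : ∀ (n : Fin 3 → ℤ) (r : E3), latticeEquiv hL n +ᵥ r = r + latticeVec L n := by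
    intro n r
    rw [← coe_latticeEquiv hL, add_comm]
    rfl
  have : Countable (Submodule.span ℤ (Set.range (latticeBasis hL))) :=
    (latticeEquiv hL).symm.injective.countable
  have : VAddInvariantMeasure (Submodule.span ℤ (Set.range (latticeBasis hL))) E3 volume :=
    inferInstanceAs <| VAddInvariantMeasure
      (Submodule.span ℤ (Set.range (latticeBasis hL))).toAddSubgroup E3 volume
  rw [← setIntegral_congr_set hae, integral_tsum, hfd.integral_eq_tsum'' g hg,
    ← (latticeEquiv hL).tsum_eq]
  · simp only [key]
  · intro n
    exact (hg.comp_add_right (latticeVec L n)).aestronglyMeasurable.restrict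
  · have h := hfd.lintegral_eq_tsum'' (fun r => ‖g r‖ₑ)
    rw [← (latticeEquiv hL).tsum_eq] at h
    simp only [key] at h
    rw [← h]
    exact hg.2.ne

/-- The plane waves at reciprocal lattice points are lattice-periodic, so the Fourier coefficients of
the damped lattice sum unfold to the Fourier transform of the damped kernel. -/
theorem cellFourierCoeff_dampedLattice {α κ : ℝ} (hα : 0 ≤ α) (hκ : 0 < κ) {L : Fin 3 → E3}
    (hL : LinearIndependent ℝ L) (m : Fin 3 → ℤ) :
    cellFourierCoeff L (dampedLattice α κ L) m
      = ((kernelTransform α κ ‖recipVec L m‖ / cellVolume L : ℝ) : ℂ) := by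
  have hint : Integrable fun x : E3 => (dampedKernel α κ x : ℂ) *
      Complex.exp (-(Complex.I * (inner ℝ (recipVec L m) x : ℝ))) := by
    refine ((integrable_dampedKernel hα hκ).ofReal (𝕜 := ℂ)).mono
      (Continuous.aestronglyMeasurable ?_) (Eventually.of_forall fun x => ?_)
    · have := continuous_dampedKernel α κ
      fun_prop
    · rw [← planeWave_neg, norm_mul, norm_planeWave, mul_one]
      rfl
  rw [cellFourierCoeff, Complex.ofReal_div, ← integral_dampedKernel_mul_cexp hα hκ,
    ← setIntegral_parallelepiped_tsum hL hint, one_div, div_eq_inv_mul]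
  congr 2
  ext r
  rw [dampedLattice_eq_tsum, Complex.ofReal_tsum, ← tsum_mul_right]
  congr 1
  ext n
  simp only [← planeWave_neg, planeWave_add, planeWave_latticeVec hL, mul_one]

/-! ### Estimates for the reciprocal-space coefficients -/

lemma rpow_three_halves {x : ℝ} (hx : 0 ≤ x) : x ^ (3 / 2 : ℝ) = x * √x := by
  rw [show (3 / 2 : ℝ) = 1 + 1 / 2 by norm_num, Real.rpow_add_of_nonneg hx (by norm_num)
    (by norm_num), Real.rpow_one, Real.sqrt_eq_rpow]

lemma gaussTransform_nonneg {s : ℝ} (hs : 0 ≤ s) (k : ℝ) : 0 ≤ gaussTransform s k := by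
  unfold gaussTransform
  positivity

lemma gaussTransform_eq {s : ℝ} (hs : 0 ≤ s) (k : ℝ) :
    gaussTransform s k
      = Real.pi * √Real.pi / (s * √s) * Real.exp (-(k ^ 2 / (4 * s))) := by
  rw [gaussTransform, rpow_three_halves (by positivity), Real.sqrt_div Real.pi_pos.le, neg_div,
    div_mul_div_comm]

/-- The decay `exp (-x) ≤ 2 / x²` absorbs the singularity of the prefactor at `s = 0`. -/
lemma gaussTransform_le {s k : ℝ} (hs : 0 ≤ s) (hk : 0 < k) :
    gaussTransform s k ≤ 32 * (Real.pi * √Real.pi) * √s * k⁻¹ ^ 4 := by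
  rw [gaussTransform_eq hs]
  rcases hs.eq_or_lt with rfl | hs
  · simp
  have h1 := exp_neg_le_two_div_sq (x := k ^ 2 / (4 * s)) (by positivity)
  calc _ ≤ Real.pi * √Real.pi / (s * √s) * (2 / (k ^ 2 / (4 * s)) ^ 2) := by gcongr
    _ = _ := by
      have h2 : s = √s * √s := (Real.mul_self_sqrt hs.le).symm
      have h3 : 0 < √s := Real.sqrt_pos.2 hs
      generalize √s = y at *
      subst h2
      field_simp
      ring

lemma norm_gaussTransform_le {α κ k t : ℝ} (hκ : 0 ≤ κ) (hk : 0 < k)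
    (ht : t ∈ Set.uIoc 0 α) (hα : 0 ≤ α) :
    ‖gaussTransform (t ^ 2 + κ) k‖
      ≤ 32 * (Real.pi * √Real.pi) * √(α ^ 2 + κ) * k⁻¹ ^ 4 := by
  rw [Set.uIoc_of_le hα] at ht
  rw [Real.norm_of_nonneg (gaussTransform_nonneg (by positivity) _)]
  refine (gaussTransform_le (by positivity) hk).trans ?_
  have := ht.1
  have := ht.2
  gcongr

lemma abs_kernelTransform_le {α κ k : ℝ} (hα : 0 ≤ α) (hκ : 0 ≤ κ) (hk : 0 < k) :
    |kernelTransform α κ k| ≤ 64 * Real.pi * √(α ^ 2 + κ) * α * k⁻¹ ^ 4 := by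
  have h := intervalIntegral.norm_integral_le_of_norm_le_const
    (f := fun t => gaussTransform (t ^ 2 + κ) k)
    (fun t ht => norm_gaussTransform_le hκ hk ht hα)
  rw [sub_zero, abs_of_nonneg hα, Real.norm_eq_abs] at h
  have hpi : 0 < √Real.pi := Real.sqrt_pos.2 Real.pi_pos
  rw [kernelTransform, abs_mul, abs_of_nonneg (by positivity)]
  calc _ ≤ 2 / √Real.pi * (32 * (Real.pi * √Real.pi) * √(α ^ 2 + κ) * k⁻¹ ^ 4 * α) := by gcongr
    _ = _ := by
      field_simp
      ring

lemma continuousAt_gaussTransform {s : ℝ} (hs : 0 < s) (k : ℝ) :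
    ContinuousAt (fun s => gaussTransform s k) s := by
  unfold gaussTransform
  have h1 : ContinuousAt (fun s : ℝ => Real.pi / s) s :=
    continuousAt_const.div continuousAt_id hs.ne'
  refine (h1.rpow_const (Or.inr (by norm_num))).mul (Real.continuous_exp.continuousAt.comp ?_)
  exact continuousAt_const.div (by fun_prop) (by positivity)

lemma measurable_gaussTransform (k : ℝ) : Measurable fun s => gaussTransform s k := by
  unfold gaussTransform
  fun_prop

lemma tendsto_kernelTransform {α k : ℝ} (hα : 0 ≤ α) (hk : 0 < k) :
    Tendsto (fun κ => kernelTransform α κ k) (𝓝[>] 0) (𝓝 (kernelTransform α 0 k)) := by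
  refine Tendsto.const_mul _ (intervalIntegral.tendsto_integral_filter_of_dominated_convergence
    (fun _ => 32 * (Real.pi * √Real.pi) * √(α ^ 2 + 1) * k⁻¹ ^ 4) ?_ ?_ ?_ ?_)
  · refine Eventually.of_forall fun κ => ?_
    exact ((measurable_gaussTransform k).comp (by fun_prop)).aestronglyMeasurable
  · filter_upwards [Ioo_mem_nhdsGT (zero_lt_one' ℝ)] with κ hκ
    refine Eventually.of_forall fun t ht => (norm_gaussTransform_le hκ.1.le hk ht hα).trans ?_
    have := hκ.2.le
    gcongr
  · exact intervalIntegrable_const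
  · refine Eventually.of_forall fun t ht => ?_
    rw [Set.uIoc_of_le hα] at ht
    have h0 : 0 < t ^ 2 + 0 := by
      have := ht.1
      positivity
    refine Tendsto.comp (continuousAt_gaussTransform h0 k) ?_
    exact (by fun_prop : Continuous fun κ : ℝ => t ^ 2 + κ).continuousWithinAt

/-- Without damping, the mixture of Gaussians can be integrated in closed form:
`(2 / k²) exp (-k² / (4 t²))` is an antiderivative of `t⁻³ exp (-k² / (4 t²))`, and tends to `0`
as `t` decreases to `0`. -/
lemma kernelTransform_zero {α k : ℝ} (hα : 0 < α) (hk : 0 < k) :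
    kernelTransform α 0 k = 4 * Real.pi / k ^ 2 * Real.exp (-k ^ 2 / (4 * α ^ 2)) := by
  have hpi : 0 < √Real.pi := Real.sqrt_pos.2 Real.pi_pos
  have hd : ∀ t : ℝ, 0 < t → HasDerivAt
      (fun t => Real.pi * √Real.pi * (2 / k ^ 2) * Real.exp (-k ^ 2 / (4 * t ^ 2)))
      (gaussTransform (t ^ 2 + 0) k) t := by
    intro t ht
    have h1 : HasDerivAt (fun t : ℝ => 4 * t ^ 2) (4 * (2 * t)) t := by
      simpa using (hasDerivAt_pow 2 t).const_mul 4
    have h2 := (((hasDerivAt_const t (-k ^ 2)).div h1 (by positivity)).exp).const_mul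
      (Real.pi * √Real.pi * (2 / k ^ 2))
    convert! h2 using 1
    rw [add_zero, gaussTransform_eq (by positivity), Real.sqrt_sq ht.le, ← neg_div, Pi.div_apply]
    field_simp
    ring
  have hint : IntervalIntegrable (fun t => gaussTransform (t ^ 2 + 0) k) volume 0 α := by
    refine (intervalIntegrable_const
      (c := 32 * (Real.pi * √Real.pi) * √(α ^ 2 + 0) * k⁻¹ ^ 4)).mono_fun'
      ((measurable_gaussTransform k).comp (by fun_prop)).aestronglyMeasurable ?_
    rw [EventuallyLE, ae_restrict_iff' measurableSet_uIoc]
    exact Eventually.of_forall fun t ht => norm_gaussTransform_le le_rfl hk ht hα.le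
  have h0 : Tendsto
      (fun t : ℝ => Real.pi * √Real.pi * (2 / k ^ 2) * Real.exp (-k ^ 2 / (4 * t ^ 2)))
      (𝓝[>] 0) (𝓝 0) := by
    suffices h : Tendsto (fun t : ℝ => -k ^ 2 / (4 * t ^ 2)) (𝓝[>] 0) atBot by
      simpa using (Real.tendsto_exp_atBot.comp h).const_mul (Real.pi * √Real.pi * (2 / k ^ 2))
    have h1 : Tendsto (fun t : ℝ => 4 * t ^ 2) (𝓝[>] 0) (𝓝[>] 0) := by
      refine tendsto_nhdsWithin_iff.2 ⟨?_, ?_⟩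
      · have : Continuous fun t : ℝ => 4 * t ^ 2 := by fun_prop
        simpa using (this.tendsto 0).mono_left nhdsWithin_le_nhds
      · filter_upwards [self_mem_nhdsWithin] with t ht
        have : 0 < t := ht
        simp only [Set.mem_Ioi]
        positivity
    have h2 := (tendsto_inv_nhdsGT_zero.comp h1).const_mul_atTop_of_neg
      (neg_lt_zero.2 (pow_pos hk 2))
    simpa only [div_eq_mul_inv, Function.comp_def] using h2
  -- The antiderivative is discontinuous at `0`, where division by zero gives it a nonzero value, so
  -- its one-sided limit is used there instead.
  rw [kernelTransform, intervalIntegral.integral_eq_sub_of_hasDerivAt_of_tendsto hα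
    (fun t ht => hd t ht.1) hint h0 ((hd α hα).continuousAt.tendsto.mono_left nhdsWithin_le_nhds)]
  field_simp
  ring

lemma recipCoeff_eq {α : ℝ} (hα : 0 < α) {L : Fin 3 → E3} (hL : LinearIndependent ℝ L)
    {m : Fin 3 → ℤ} (hm : m ≠ 0) :
    recipCoeff α L m = kernelTransform α 0 ‖recipVec L m‖ / cellVolume L := by
  rw [kernelTransform_zero hα (norm_pos_iff.2 (recipVec_ne_zero hL hm)), recipCoeff]
  have := cellVolume_pos hL
  field_simp

/-- A bound for the Fourier coefficients of the damped lattice sums which is uniform in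
`0 ≤ κ ≤ K`. -/
lemma norm_kernelTransform_div_le {α κ K : ℝ} (hα : 0 ≤ α) (hκ : 0 ≤ κ) (hκK : κ ≤ K)
    {L : Fin 3 → E3} (hL : LinearIndependent ℝ L) {m : Fin 3 → ℤ} (hm : m ≠ 0) :
    ‖((kernelTransform α κ ‖recipVec L m‖ / cellVolume L : ℝ) : ℂ)‖
      ≤ 64 * Real.pi * √(α ^ 2 + K) * α / cellVolume L * ‖recipVec L m‖⁻¹ ^ 4 := by
  have hV := cellVolume_pos hL
  rw [Complex.norm_real, Real.norm_eq_abs, abs_div, abs_of_pos hV, div_mul_eq_mul_div]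
  refine div_le_div_of_nonneg_right ?_ hV.le
  refine (abs_kernelTransform_le hα hκ (norm_pos_iff.2 (recipVec_ne_zero hL hm))).trans ?_
  gcongr

lemma summable_inv_norm_recipVec_pow {L : Fin 3 → E3} (hL : LinearIndependent ℝ L) :
    Summable fun m : Fin 3 → ℤ => ‖recipVec L m‖⁻¹ ^ 4 :=
  summable_inv_norm_latticeVec_pow (linearIndependent_recipBasis hL)

/-! ### The Fourier series of the damped lattice sum -/

theorem hasSum_dampedLattice {α κ : ℝ} (hα : 0 ≤ α) (hκ : 0 < κ) {L : Fin 3 → E3}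
    (hL : LinearIndependent ℝ L) (r : E3) :
    HasSum (fun m : Fin 3 → ℤ => cellFourierCoeff L (dampedLattice α κ L) m * planeWave L m r)
      (dampedLattice α κ L r : ℂ) := by
  refine hasSum_cellFourierCoeff hL (continuous_dampedLattice hα hκ hL)
    (dampedLattice_add_latticeVec α κ L) ?_ r
  refine summable_of_le_inv_norm_latticeVec_pow (linearIndependent_recipBasis hL)
    (C := 64 * Real.pi * √(α ^ 2 + κ) * α / cellVolume L) fun m hm => ?_
  rw [cellFourierCoeff_dampedLattice hα hκ hL]
  exact norm_kernelTransform_div_le hα hκ.le le_rfl hL hm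

theorem tendsto_cellFourierCoeff_dampedLattice {α : ℝ} (hα : 0 < α) {L : Fin 3 → E3}
    (hL : LinearIndependent ℝ L) {m : Fin 3 → ℤ} (hm : m ≠ 0) :
    Tendsto (fun κ : ℝ => cellFourierCoeff L (dampedLattice α κ L) m) (𝓝[>] 0)
      (𝓝 (recipCoeff α L m : ℂ)) := by
  have h : Tendsto (fun κ : ℝ => ((kernelTransform α κ ‖recipVec L m‖ / cellVolume L : ℝ) : ℂ))
      (𝓝[>] 0) (𝓝 (recipCoeff α L m : ℂ)) := by
    rw [recipCoeff_eq hα hL hm]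
    exact (Complex.continuous_ofReal.tendsto _).comp
      ((tendsto_kernelTransform hα.le (norm_pos_iff.2 (recipVec_ne_zero hL hm))).div_const _)
  refine h.congr' ?_
  filter_upwards [self_mem_nhdsWithin] with κ hκ
  exact (cellFourierCoeff_dampedLattice hα.le hκ hL m).symm

lemma summable_recipCoeff_mul_planeWave {α : ℝ} (hα : 0 < α) {L : Fin 3 → E3}
    (hL : LinearIndependent ℝ L) (r : E3) :
    Summable fun m : {m : Fin 3 → ℤ // m ≠ 0} => (recipCoeff α L m : ℂ) * planeWave L m r := by
  refine Summable.of_norm_bounded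
    (((summable_inv_norm_recipVec_pow hL).mul_left
      (64 * Real.pi * √(α ^ 2 + 0) * α / cellVolume L)).comp_injective Subtype.val_injective)
    fun m => ?_
  rw [norm_mul, norm_planeWave, mul_one, recipCoeff_eq hα hL m.2]
  exact norm_kernelTransform_div_le hα.le le_rfl le_rfl hL m.2

/-- Away from the zero mode, the Fourier series of the damped lattice sums are dominated uniformly
in the damping, so their limit may be taken term by term. -/
theorem tendsto_dampedLattice_sub {α : ℝ} (hα : 0 < α) {L : Fin 3 → E3}
    (hL : LinearIndependent ℝ L) (r : E3) :
    Tendsto (fun κ : ℝ => (dampedLattice α κ L r : ℂ) -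
        cellFourierCoeff L (dampedLattice α κ L) 0) (𝓝[>] 0)
      (𝓝 (∑' m : {m : Fin 3 → ℤ // m ≠ 0}, (recipCoeff α L m : ℂ) * planeWave L m r)) := by
  have h : Tendsto (fun κ : ℝ => ∑' m : {m : Fin 3 → ℤ // m ≠ 0},
      cellFourierCoeff L (dampedLattice α κ L) m * planeWave L m r) (𝓝[>] 0)
      (𝓝 (∑' m : {m : Fin 3 → ℤ // m ≠ 0}, (recipCoeff α L m : ℂ) * planeWave L m r)) := by
    refine tendsto_tsum_of_dominated_convergence
      (((summable_inv_norm_recipVec_pow hL).mul_left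
        (64 * Real.pi * √(α ^ 2 + 1) * α / cellVolume L)).comp_injective Subtype.val_injective)
      (fun m => (tendsto_cellFourierCoeff_dampedLattice hα hL m.2).mul_const _) ?_
    filter_upwards [Ioo_mem_nhdsGT (zero_lt_one' ℝ)] with κ hκ m
    rw [norm_mul, norm_planeWave, mul_one, cellFourierCoeff_dampedLattice hα.le hκ.1 hL]
    exact norm_kernelTransform_div_le hα.le hκ.1.le hκ.2.le hL m.2
  refine h.congr' ?_
  filter_upwards [self_mem_nhdsWithin] with κ hκ
  have h1 := (Finset.hasSum_compl_iff
    (f := fun m => cellFourierCoeff L (dampedLattice α κ L) m * planeWave L m r)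
    (a := (dampedLattice α κ L r : ℂ) -
    cellFourierCoeff L (dampedLattice α κ L) 0) ({0} : Finset (Fin 3 → ℤ))).2 (by
      have hw : planeWave L 0 r = 1 := by simp [planeWave, recipVec]
      simpa [hw] using hasSum_dampedLattice hα.le hκ hL r)
  rw [← h1.tsum_eq]
  refine (Equiv.subtypeEquivRight fun m => ?_).tsum_eq
    (fun m : {m : Fin 3 → ℤ // m ∉ ({0} : Finset (Fin 3 → ℤ))} =>
      cellFourierCoeff L (dampedLattice α κ L) m * planeWave L m r)
  simp

/-! ### Energies -/

section Energy

variable {N : ℕ} (ke α : ℝ) (L : Fin 3 → E3) (q : Fin N → ℝ) (R : Fin N → E3)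

lemma dampedEnergy_eq {α κ : ℝ} (hα : 0 ≤ α) (hκ : 0 < κ) {L : Fin 3 → E3}
    (hL : LinearIndependent ℝ L) :
    dampedEnergy ke α κ L q R
      = ke / 2 * ∑ i, ∑ j, q i * q j * dampedLattice α κ L (R i - R j) := by
  have hs : ∀ i j, Summable fun n : Fin 3 → ℤ =>
      q i * q j * dampedKernel α κ (R i - R j + latticeVec L n) := fun i j =>
    (summable_dampedKernel hα hκ hL _).mul_left _
  rw [dampedEnergy]
  congr 1
  have h : ∀ (n : Fin 3 → ℤ) (i j : Fin N),
      q i * q j * (screened α ‖R i + latticeVec L n - R j‖ *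
        Real.exp (-κ * ‖R i + latticeVec L n - R j‖ ^ 2))
      = q i * q j * dampedKernel α κ (R i - R j + latticeVec L n) := fun n i j => by
    rw [dampedKernel, add_sub_right_comm]
  simp only [h]
  rw [Summable.tsum_finsetSum fun i _ => summable_sum fun j _ => hs i j]
  refine Finset.sum_congr rfl fun i _ => ?_
  rw [Summable.tsum_finsetSum fun j _ => hs i j]
  refine Finset.sum_congr rfl fun j _ => ?_
  rw [tsum_mul_left, dampedLattice_eq_tsum]

lemma recipTerm_eq (m : Fin 3 → ℤ) :
    recipTerm ke α L q R m = ∑ i, ∑ j, ((ke / 2 * (q i * q j) : ℝ) : ℂ) *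
      ((recipCoeff α L m : ℂ) * planeWave L m (R i - R j)) := by
  simp only [recipTerm, Complex.ofReal_mul, mul_assoc]

variable {α L}

lemma hasSum_recipTerm (hα : 0 < α) (hL : LinearIndependent ℝ L) :
    HasSum (fun m : {m : Fin 3 → ℤ // m ≠ 0} => recipTerm ke α L q R m)
      (∑ i, ∑ j, ((ke / 2 * (q i * q j) : ℝ) : ℂ) *
        ∑' m : {m : Fin 3 → ℤ // m ≠ 0}, (recipCoeff α L m : ℂ) * planeWave L m (R i - R j)) := by
  simp only [recipTerm_eq]
  exact hasSum_sum fun i _ => hasSum_sum fun j _ =>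
    (summable_recipCoeff_mul_planeWave hα hL _).hasSum.mul_left _

/-- The zero modes of the pair interactions add up to `(∑ i, q i) ^ 2` times that of the damped
lattice sum. -/
theorem tendsto_dampedEnergy_sub (hα : 0 < α) (hL : LinearIndependent ℝ L) :
    Tendsto (fun κ : ℝ => (dampedEnergy ke α κ L q R : ℂ) -
        ((ke / 2 * (∑ i, q i) ^ 2 : ℝ) : ℂ) * cellFourierCoeff L (dampedLattice α κ L) 0)
      (𝓝[>] 0) (𝓝 (recipEnergy ke α L q R)) := by
  rw [recipEnergy, (hasSum_recipTerm ke q R hα hL).tsum_eq]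
  have h := tendsto_finsetSum Finset.univ fun i _ => tendsto_finsetSum Finset.univ fun j _ =>
    (tendsto_dampedLattice_sub hα hL (R i - R j)).const_mul ((ke / 2 * (q i * q j) : ℝ) : ℂ)
  refine h.congr' ?_
  filter_upwards [self_mem_nhdsWithin] with κ hκ
  rw [dampedEnergy_eq ke q R hα.le hκ hL]
  simp only [mul_sub, Finset.sum_sub_distrib]
  congr 1
  · push_cast
    simp only [Finset.mul_sum, mul_assoc]
  · simp only [← Finset.sum_mul, ← Complex.ofReal_sum]
    congr 2
    rw [sq, Finset.sum_mul_sum, Finset.mul_sum]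
    simp only [Finset.mul_sum]

end Energy

/-! ### Second-order expansion of shifted Gaussians -/

/-- A second-order Taylor estimate on the unit interval, with the derivatives given explicitly. -/
lemma abs_taylor_two_le {g g₁ g₂ g₃ : ℝ → ℝ} (h₁ : ∀ u, HasDerivAt g (g₁ u) u)
    (h₂ : ∀ u, HasDerivAt g₁ (g₂ u) u) (h₃ : ∀ u, HasDerivAt g₂ (g₃ u) u) {M : ℝ}
    (hM : ∀ u ∈ Set.Icc (0 : ℝ) 1, |g₃ u| ≤ M) :
    |g 1 - (g 0 + g₁ 0 + g₂ 0 / 2)| ≤ M := by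
  have hM0 : 0 ≤ M := (abs_nonneg _).trans (hM 0 (by simp))
  have key : ∀ {f f' : ℝ → ℝ}, (∀ u, HasDerivAt f (f' u) u) →
      (∀ u ∈ Set.Icc (0 : ℝ) 1, |f' u| ≤ M) → ∀ u ∈ Set.Icc (0 : ℝ) 1, |f u - f 0| ≤ M := by
    intro f f' hf hf' u hu
    have h := (convex_Icc (0 : ℝ) 1).norm_image_sub_le_of_norm_hasDerivWithin_le
      (fun x _ => (hf x).hasDerivWithinAt) hf' (by simp : (0 : ℝ) ∈ Set.Icc (0 : ℝ) 1) hu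
    rw [sub_zero, Real.norm_eq_abs, Real.norm_eq_abs, abs_of_nonneg hu.1] at h
    nlinarith [hu.2]
  -- The mean value inequality is applied to `g₂`, `g₁` and `g`, each without its Taylor polynomial.
  have k₂ := key h₃ hM
  have k₁ := key (f := fun u => g₁ u - g₂ 0 * u) (f' := fun u => g₂ u - g₂ 0)
    (fun u => by
      convert! (h₂ u).sub ((hasDerivAt_id u).const_mul (g₂ 0)) using 1
      simp) k₂
  have k₀ := key (f := fun u => g u - g₁ 0 * u - g₂ 0 / 2 * u ^ 2)
    (f' := fun u => g₁ u - g₂ 0 * u - (g₁ 0 - g₂ 0 * 0))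
    (fun u => by
      have := ((h₁ u).sub ((hasDerivAt_id u).const_mul (g₁ 0))).sub
        ((hasDerivAt_pow 2 u).const_mul (g₂ 0 / 2))
      convert! this using 1
      simp
      ring) k₁ 1 (by simp)
  convert k₀ using 2
  ring

/-- The constant is `27 * 3! * 8 ^ 3 + 18 * 2! * 8 ^ 2`, from `(x / 8) ^ k / k! ≤ exp (x / 8)`. -/
lemma exp_neg_mul_cubic_le {x : ℝ} (hx : 0 ≤ x) :
    (27 * x ^ 3 + 18 * x ^ 2) * Real.exp (-(x / 4)) ≤ 85248 * Real.exp (-(x / 8)) := by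
  have h2 := Real.pow_div_factorial_le_exp (x / 8) (by positivity) 2
  have h3 := Real.pow_div_factorial_le_exp (x / 8) (by positivity) 3
  have h : 27 * x ^ 3 + 18 * x ^ 2 ≤ 85248 * Real.exp (x / 8) := by
    norm_num [Nat.factorial] at h2 h3
    nlinarith
  calc _ ≤ 85248 * Real.exp (x / 8) * Real.exp (-(x / 4)) := by gcongr
    _ = _ := by
      rw [mul_assoc, ← Real.exp_add]
      ring_nf

/-- The remainder of the second-order expansion of `exp (-s ‖v + d‖²)` in `d`. With `x = s ‖v‖²`,
the third derivative of `u ↦ exp (-s ‖v + u d‖²)` is at most `D³ ‖v‖⁻³` times a cubic polynomial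
in `x` times `exp (-x / 4)`. -/
lemma abs_gaussian_taylor_le {s D : ℝ} (hs : 0 ≤ s) {v d : E3} (hd : ‖d‖ ≤ D) (hv : 2 * D ≤ ‖v‖)
    (hv0 : v ≠ 0) :
    |Real.exp (-s * ‖d + v‖ ^ 2) - Real.exp (-s * ‖v‖ ^ 2) *
        (1 - 2 * s * inner ℝ v d + 2 * s ^ 2 * (inner ℝ v d) ^ 2 - s * ‖d‖ ^ 2)|
      ≤ 85248 * D ^ 3 * ‖v‖⁻¹ ^ 3 * Real.exp (-(‖v‖ ^ 2 / 8) * s) := by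
  have hD : 0 ≤ D := (norm_nonneg d).trans hd
  have ha : 0 < ‖v‖ := norm_pos_iff.2 hv0
  set b := inner ℝ v d with hb
  set c := ‖d‖ ^ 2 with hc
  have hp : ∀ u : ℝ, ‖v + u • d‖ ^ 2 = ‖v‖ ^ 2 + 2 * u * b + u ^ 2 * c := by
    intro u
    rw [norm_add_sq_real, real_inner_smul_right, norm_smul, mul_pow, Real.norm_eq_abs, sq_abs]
    ring
  -- The Gaussian along the segment from `v` to `v + d`.
  let g : ℝ → ℝ := fun u => Real.exp (-s * (‖v‖ ^ 2 + 2 * u * b + u ^ 2 * c))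
  have e₁ : ∀ u, HasDerivAt (fun u : ℝ => 2 * b + 2 * u * c) (2 * c) u := fun u => by
    simpa using (((hasDerivAt_id u).const_mul 2).mul_const c).const_add (2 * b)
  have e₀ : ∀ u, HasDerivAt g (-s * (2 * b + 2 * u * c) * g u) u := fun u => by
    have h1 : HasDerivAt (fun u : ℝ => ‖v‖ ^ 2 + 2 * u * b + u ^ 2 * c) (2 * b + 2 * u * c) u := by
      have := ((((hasDerivAt_id u).const_mul 2).mul_const b).const_add (‖v‖ ^ 2)).add
        ((hasDerivAt_pow 2 u).mul_const c)
      convert! this using 1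
      simp
    convert! (h1.const_mul (-s)).exp using 1
    simp only [g]
    ring
  have e₂ : ∀ u, HasDerivAt (fun u => -s * (2 * b + 2 * u * c) * g u)
      ((s ^ 2 * (2 * b + 2 * u * c) ^ 2 - 2 * s * c) * g u) u := fun u => by
    convert! ((e₁ u).const_mul (-s)).mul (e₀ u) using 1
    ring
  have e₃ : ∀ u, HasDerivAt (fun u => (s ^ 2 * (2 * b + 2 * u * c) ^ 2 - 2 * s * c) * g u)
      ((-(s ^ 3 * (2 * b + 2 * u * c) ^ 3) + 6 * s ^ 2 * (2 * b + 2 * u * c) * c) * g u) u :=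
    fun u => by
      convert! ((((e₁ u).pow 2).const_mul (s ^ 2)).sub_const (2 * s * c)).mul (e₀ u) using 1
      simp
      ring
  have hM : ∀ u ∈ Set.Icc (0 : ℝ) 1,
      |(-(s ^ 3 * (2 * b + 2 * u * c) ^ 3) + 6 * s ^ 2 * (2 * b + 2 * u * c) * c) * g u|
        ≤ 85248 * D ^ 3 * ‖v‖⁻¹ ^ 3 * Real.exp (-(‖v‖ ^ 2 / 8) * s) := by
    intro u hu
    have hud : ‖u • d‖ ≤ ‖v‖ / 2 := by
      rw [norm_smul, Real.norm_of_nonneg hu.1]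
      nlinarith [hu.2, norm_nonneg d]
    have hy1 : ‖v‖ / 2 ≤ ‖v + u • d‖ := by
      have := norm_sub_le (v + u • d) (u • d)
      rw [add_sub_cancel_right] at this
      linarith
    have hy2 : ‖v + u • d‖ ≤ 3 / 2 * ‖v‖ := by
      have := norm_add_le v (u • d)
      linarith
    have hp' : |2 * b + 2 * u * c| ≤ 3 * ‖v‖ * D := by
      have h1 : 2 * b + 2 * u * c = 2 * inner ℝ (v + u • d) d := by
        rw [inner_add_left, real_inner_smul_left, real_inner_self_eq_norm_sq]
        ring
      rw [h1, abs_mul, abs_two]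
      have h2 := abs_real_inner_le_norm (v + u • d) d
      have h3 : ‖v + u • d‖ * ‖d‖ ≤ 3 / 2 * ‖v‖ * D := by gcongr
      linarith
    have hcD : c ≤ D ^ 2 := by
      rw [hc]
      gcongr
    have hc0 : 0 ≤ c := by positivity
    have hg : g u ≤ Real.exp (-(s * ‖v‖ ^ 2 / 4)) := by
      simp only [g, ← hp]
      rw [Real.exp_le_exp]
      have : (‖v‖ / 2) ^ 2 ≤ ‖v + u • d‖ ^ 2 := by gcongr
      nlinarith
    calc _ = |-(s ^ 3 * (2 * b + 2 * u * c) ^ 3) + 6 * s ^ 2 * (2 * b + 2 * u * c) * c| * g u := by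
          rw [abs_mul, abs_of_pos (Real.exp_pos _)]
      _ ≤ (s ^ 3 * (3 * ‖v‖ * D) ^ 3 + 6 * s ^ 2 * (3 * ‖v‖ * D) * D ^ 2) *
            Real.exp (-(s * ‖v‖ ^ 2 / 4)) := by
          refine mul_le_mul ?_ hg (Real.exp_pos _).le (by positivity)
          refine (abs_add_le _ _).trans ?_
          rw [abs_neg, abs_mul, abs_mul, abs_mul, abs_pow (2 * b + 2 * u * c), abs_of_nonneg hc0,
            abs_of_nonneg (by positivity : 0 ≤ s ^ 3), abs_of_nonneg (by positivity : 0 ≤ 6 * s ^ 2)]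
          gcongr
      _ = D ^ 3 * ‖v‖⁻¹ ^ 3 * ((27 * (s * ‖v‖ ^ 2) ^ 3 + 18 * (s * ‖v‖ ^ 2) ^ 2) *
            Real.exp (-(s * ‖v‖ ^ 2 / 4))) := by
          field_simp
          ring
      _ ≤ D ^ 3 * ‖v‖⁻¹ ^ 3 * (85248 * Real.exp (-(s * ‖v‖ ^ 2 / 8))) := by
          exact mul_le_mul_of_nonneg_left (exp_neg_mul_cubic_le (by positivity)) (by positivity)
      _ = _ := by ring_nf
  have h := abs_taylor_two_le e₀ e₂ e₃ hM
  have h1 : g 1 = Real.exp (-s * ‖d + v‖ ^ 2) := by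
    have := hp 1
    rw [one_smul] at this
    rw [add_comm d v, this]
  have h0 : g 0 = Real.exp (-s * ‖v‖ ^ 2) := by simp [g]
  rw [h1, h0] at h
  convert h using 3
  ring

/-! ### Cancellation for neutral cells without dipole moment -/

lemma sum_charge_mul_sub_eq_zero {N : ℕ} {q A : Fin N → ℝ} (hq : ∑ i, q i = 0) :
    ∑ i, ∑ j, q i * q j * (A i - A j) = 0 := by
  have h : ∀ i, ∑ j, q i * q j * (A i - A j) = q i * -∑ j, q j * A j := by
    intro i
    have : ∀ j, q i * q j * (A i - A j) = q i * A i * q j - q i * (q j * A j) := fun j => by ring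
    simp only [this, Finset.sum_sub_distrib, ← Finset.mul_sum, hq]
    ring
  simp only [h, ← Finset.sum_mul, hq, zero_mul]

lemma sum_charge_mul_sub_sq_eq_zero {N : ℕ} {q A : Fin N → ℝ} (hq : ∑ i, q i = 0)
    (hA : ∑ i, q i * A i = 0) : ∑ i, ∑ j, q i * q j * (A i - A j) ^ 2 = 0 := by
  have h : ∀ i, ∑ j, q i * q j * (A i - A j) ^ 2 = q i * ∑ j, q j * A j ^ 2 := by
    intro i
    have : ∀ j, q i * q j * (A i - A j) ^ 2
        = q i * A i ^ 2 * q j - 2 * q i * A i * (q j * A j) + q i * (q j * A j ^ 2) :=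
      fun j => by ring
    simp only [this, Finset.sum_add_distrib, Finset.sum_sub_distrib, ← Finset.mul_sum, hq, hA]
    ring
  simp only [h, ← Finset.sum_mul, hq, zero_mul]

section Dipole

variable {N : ℕ} {q : Fin N → ℝ} {R : Fin N → E3}

/-- The second-order Taylor polynomial of the pair interaction is annihilated by the charges. -/
lemma sum_charge_mul_taylor_eq_zero (hq : ∑ i, q i = 0) (hR : ∑ i, q i • R i = 0) (s : ℝ)
    (v : E3) :
    ∑ i, ∑ j, q i * q j * (1 - 2 * s * inner ℝ v (R i - R j) +
      2 * s ^ 2 * (inner ℝ v (R i - R j)) ^ 2 - s * ‖R i - R j‖ ^ 2) = 0 := by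
  have hv : ∑ i, q i * inner ℝ v (R i) = 0 := by
    have := congrArg (fun w => inner ℝ v w) hR
    simpa [inner_sum, real_inner_smul_right] using this
  have hk : ∀ k, ∑ i, q i * R i k = 0 := by
    intro k
    have := congrArg (fun w : E3 => w k) hR
    simpa using this
  have h : ∀ i j, q i * q j * (1 - 2 * s * inner ℝ v (R i - R j) +
      2 * s ^ 2 * (inner ℝ v (R i - R j)) ^ 2 - s * ‖R i - R j‖ ^ 2)
      = q i * q j - 2 * s * (q i * q j * (inner ℝ v (R i) - inner ℝ v (R j)))
        + 2 * s ^ 2 * (q i * q j * (inner ℝ v (R i) - inner ℝ v (R j)) ^ 2)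
        - s * (q i * q j * ∑ k, (R i k - R j k) ^ 2) := by
    intro i j
    rw [EuclideanSpace.real_norm_sq_eq, inner_sub_right]
    simp only [PiLp.sub_apply]
    ring
  have h3 : ∑ i, ∑ j, q i * q j * ∑ k, (R i k - R j k) ^ 2 = 0 := by
    simp only [Finset.mul_sum, Finset.sum_comm (s := (Finset.univ : Finset (Fin N)))
      (t := (Finset.univ : Finset (Fin 3)))]
    exact Finset.sum_eq_zero fun k _ => sum_charge_mul_sub_sq_eq_zero hq (hk k)
  simp only [h, Finset.sum_add_distrib, Finset.sum_sub_distrib, ← Finset.mul_sum]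
  rw [sum_charge_mul_sub_eq_zero hq, sum_charge_mul_sub_sq_eq_zero hq hv, h3, hq]
  simp

lemma abs_sum_charge_gaussian_le (hq : ∑ i, q i = 0) (hR : ∑ i, q i • R i = 0) {s D : ℝ}
    (hs : 0 ≤ s) (hD : ∀ i j, ‖R i - R j‖ ≤ D) {v : E3} (hv : 2 * D ≤ ‖v‖) (hv0 : v ≠ 0) :
    |∑ i, ∑ j, q i * q j * Real.exp (-s * ‖R i - R j + v‖ ^ 2)|
      ≤ (∑ i, ∑ j, |q i * q j|) *
        (85248 * D ^ 3 * ‖v‖⁻¹ ^ 3 * Real.exp (-(‖v‖ ^ 2 / 8) * s)) := by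
  have h0 : ∑ i, ∑ j, q i * q j * Real.exp (-s * ‖R i - R j + v‖ ^ 2)
      = ∑ i, ∑ j, q i * q j * (Real.exp (-s * ‖R i - R j + v‖ ^ 2) - Real.exp (-s * ‖v‖ ^ 2) *
        (1 - 2 * s * inner ℝ v (R i - R j) + 2 * s ^ 2 * (inner ℝ v (R i - R j)) ^ 2
          - s * ‖R i - R j‖ ^ 2)) := by
    have := congrArg (fun x => Real.exp (-s * ‖v‖ ^ 2) * x) (sum_charge_mul_taylor_eq_zero hq hR s v)
    simp only [Finset.mul_sum, mul_zero] at this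
    rw [← sub_zero (∑ i, ∑ j, q i * q j * Real.exp (-s * ‖R i - R j + v‖ ^ 2)), ← this]
    simp only [← Finset.sum_sub_distrib]
    refine Finset.sum_congr rfl fun i _ => Finset.sum_congr rfl fun j _ => ?_
    ring
  rw [h0, Finset.sum_mul]
  refine (Finset.abs_sum_le_sum_abs _ _).trans (Finset.sum_le_sum fun i _ => ?_)
  rw [Finset.sum_mul]
  refine (Finset.abs_sum_le_sum_abs _ _).trans (Finset.sum_le_sum fun j _ => ?_)
  rw [abs_mul]
  gcongr
  exact abs_gaussian_taylor_le hs (hD i j) hv hv0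

/-- The damped interaction of the cell with its translate by `v`. -/
noncomputable def imageEnergy (α κ : ℝ) (q : Fin N → ℝ) (R : Fin N → E3) (v : E3) : ℝ :=
  ∑ i, ∑ j, q i * q j * dampedKernel α κ (R i - R j + v)

lemma imageEnergy_eq_integral (α κ : ℝ) (v : E3) :
    imageEnergy α κ q R v = 2 / √Real.pi * ∫ t in (0 : ℝ)..α,
      ∑ i, ∑ j, q i * q j * Real.exp (-(t ^ 2 + κ) * ‖R i - R j + v‖ ^ 2) := by
  have hi : ∀ i j, IntervalIntegrable
      (fun t => q i * q j * Real.exp (-(t ^ 2 + κ) * ‖R i - R j + v‖ ^ 2)) volume 0 α :=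
    fun i j => Continuous.intervalIntegrable (by fun_prop) _ _
  rw [imageEnergy, intervalIntegral.integral_finsetSum fun i _ =>
    Continuous.intervalIntegrable (by fun_prop) _ _, Finset.mul_sum]
  refine Finset.sum_congr rfl fun i _ => ?_
  rw [intervalIntegral.integral_finsetSum fun j _ => hi i j, Finset.mul_sum]
  refine Finset.sum_congr rfl fun j _ => ?_
  rw [dampedKernel_eq_integral, intervalIntegral.integral_const_mul]
  ring

lemma abs_imageEnergy_le {α κ : ℝ} (hα : 0 ≤ α) (hκ : 0 ≤ κ) (v : E3) :
    |imageEnergy α κ q R v| ≤ (∑ i, ∑ j, |q i * q j|) * (2 / √Real.pi * α) := by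
  rw [imageEnergy, Finset.sum_mul]
  refine (Finset.abs_sum_le_sum_abs _ _).trans (Finset.sum_le_sum fun i _ => ?_)
  rw [Finset.sum_mul]
  refine (Finset.abs_sum_le_sum_abs _ _).trans (Finset.sum_le_sum fun j _ => ?_)
  rw [abs_mul, abs_of_nonneg (dampedKernel_nonneg hα _ _)]
  gcongr
  refine (dampedKernel_le hα κ _).trans (mul_le_of_le_one_right (by positivity) ?_)
  rw [Real.exp_le_one_iff]
  nlinarith [mul_nonneg hκ (sq_nonneg ‖R i - R j + v‖)]

lemma integral_exp_neg_mul_sq_le {α b : ℝ} (hα : 0 ≤ α) (hb : 0 < b) :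
    ∫ t in (0 : ℝ)..α, Real.exp (-b * t ^ 2) ≤ √(Real.pi / b) / 2 := by
  rw [← integral_gaussian_Ioi, intervalIntegral.integral_of_le hα]
  exact setIntegral_mono_set (integrable_exp_neg_mul_sq hb).integrableOn
    (Eventually.of_forall fun _ => (Real.exp_pos _).le)
    (Set.Ioc_subset_Ioi_self.eventuallyLE)

/-- The interaction with a distant image of a neutral cell without dipole moment decays like the
inverse fourth power of the distance, uniformly in the damping. -/
theorem abs_imageEnergy_le_of_dipole (hq : ∑ i, q i = 0) (hR : ∑ i, q i • R i = 0) {α κ D : ℝ}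
    (hα : 0 ≤ α) (hκ : 0 ≤ κ) (hD : ∀ i j, ‖R i - R j‖ ≤ D) (hD0 : 0 ≤ D) {v : E3}
    (hv : 2 * D ≤ ‖v‖) (hv0 : v ≠ 0) :
    |imageEnergy α κ q R v|
      ≤ 2 / √Real.pi * ((∑ i, ∑ j, |q i * q j|) * (85248 * D ^ 3) * (√(8 * Real.pi) / 2)) *
        ‖v‖⁻¹ ^ 4 := by
  have ha : 0 < ‖v‖ := norm_pos_iff.2 hv0
  set C := (∑ i, ∑ j, |q i * q j|) * (85248 * D ^ 3) with hC
  have hC0 : 0 ≤ C := mul_nonneg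
    (Finset.sum_nonneg fun i _ => Finset.sum_nonneg fun j _ => abs_nonneg _) (by positivity)
  have h1 : ‖∫ t in (0 : ℝ)..α,
      ∑ i, ∑ j, q i * q j * Real.exp (-(t ^ 2 + κ) * ‖R i - R j + v‖ ^ 2)‖
      ≤ ∫ t in (0 : ℝ)..α, C * ‖v‖⁻¹ ^ 3 * Real.exp (-(‖v‖ ^ 2 / 8) * t ^ 2) := by
    refine intervalIntegral.norm_integral_le_of_norm_le hα (Eventually.of_forall fun t _ => ?_)
      (Continuous.intervalIntegrable (by fun_prop) _ _)
    refine (abs_sum_charge_gaussian_le hq hR (by positivity : 0 ≤ t ^ 2 + κ) hD hv hv0).trans ?_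
    rw [← mul_assoc, ← mul_assoc, ← hC]
    refine mul_le_mul_of_nonneg_left (Real.exp_le_exp.2 ?_) (by positivity)
    have : 0 ≤ ‖v‖ ^ 2 / 8 * κ := by positivity
    linarith
  have h2 : ∫ t in (0 : ℝ)..α, Real.exp (-(‖v‖ ^ 2 / 8) * t ^ 2) ≤ √(8 * Real.pi) / 2 * ‖v‖⁻¹ := by
    refine (integral_exp_neg_mul_sq_le hα (by positivity)).trans (le_of_eq ?_)
    rw [show Real.pi / (‖v‖ ^ 2 / 8) = 8 * Real.pi / ‖v‖ ^ 2 by field_simp,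
      Real.sqrt_div (by positivity), Real.sqrt_sq ha.le]
    ring
  rw [intervalIntegral.integral_const_mul, Real.norm_eq_abs] at h1
  rw [imageEnergy_eq_integral, abs_mul, abs_of_nonneg (by positivity : 0 ≤ 2 / √Real.pi), mul_assoc]
  gcongr
  refine h1.trans ?_
  calc _ ≤ C * ‖v‖⁻¹ ^ 3 * (√(8 * Real.pi) / 2 * ‖v‖⁻¹) := by gcongr
    _ = _ := by ring

/-- For a neutral cell without dipole moment, the image energies are dominated by a summable
series, uniformly in the damping. -/
theorem exists_summable_bound_imageEnergy (hq : ∑ i, q i = 0) (hR : ∑ i, q i • R i = 0) {α : ℝ}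
    (hα : 0 ≤ α) {L : Fin 3 → E3} (hL : LinearIndependent ℝ L) :
    ∃ B : (Fin 3 → ℤ) → ℝ, Summable B ∧
      ∀ κ, 0 ≤ κ → ∀ n, |imageEnergy α κ q R (latticeVec L n)| ≤ B n := by
  obtain ⟨D, hD0, hD⟩ : ∃ D : ℝ, 0 ≤ D ∧ ∀ i j, ‖R i - R j‖ ≤ D := by
    refine ⟨∑ i, ∑ j, ‖R i - R j‖, by positivity, fun i j => ?_⟩
    exact (Finset.single_le_sum (f := fun j => ‖R i - R j‖) (fun _ _ => norm_nonneg _)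
      (Finset.mem_univ j)).trans (Finset.single_le_sum (f := fun i => ∑ j, ‖R i - R j‖)
        (fun _ _ => by positivity) (Finset.mem_univ i))
  set K₀ := (∑ i, ∑ j, |q i * q j|) * (2 / √Real.pi * α)
  set K₁ := 2 / √Real.pi * ((∑ i, ∑ j, |q i * q j|) * (85248 * D ^ 3) * (√(8 * Real.pi) / 2))
  have hQ : 0 ≤ ∑ i, ∑ j, |q i * q j| :=
    Finset.sum_nonneg fun i _ => Finset.sum_nonneg fun j _ => abs_nonneg _
  have hK₀ : 0 ≤ K₀ := by positivity
  have hK₁ : 0 ≤ K₁ := by positivity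
  -- The first term covers both near and distant images; at `n = 0` it vanishes, as `0⁻¹ = 0`.
  refine ⟨fun n => (K₁ + K₀ * (2 * D) ^ 4) * ‖latticeVec L n‖⁻¹ ^ 4 + if n = 0 then K₀ else 0,
    ((summable_inv_norm_latticeVec_pow hL).mul_left _).add (hasSum_ite_eq 0 K₀).summable,
    fun κ hκ n => ?_⟩
  by_cases hn : n = 0
  · simp only [hn, if_true]
    exact (abs_imageEnergy_le hα hκ _).trans (le_add_of_nonneg_left (by positivity))
  simp only [hn, if_false, add_zero]
  have hv0 := latticeVec_ne_zero hL hn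
  have ha : 0 < ‖latticeVec L n‖ := norm_pos_iff.2 hv0
  rcases le_or_gt (2 * D) ‖latticeVec L n‖ with hv | hv
  · refine (abs_imageEnergy_le_of_dipole hq hR hα hκ hD hD0 hv hv0).trans ?_
    gcongr
    exact le_add_of_nonneg_right (by positivity)
  · refine (abs_imageEnergy_le hα hκ _).trans ?_
    have h1 : 1 ≤ (2 * D) ^ 4 * ‖latticeVec L n‖⁻¹ ^ 4 := by
      rw [← mul_pow]
      refine one_le_pow₀ ?_
      rw [← div_eq_mul_inv, one_le_div ha]
      exact hv.le
    calc K₀ ≤ K₀ * ((2 * D) ^ 4 * ‖latticeVec L n‖⁻¹ ^ 4) := le_mul_of_one_le_right hK₀ h1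
      _ ≤ _ := by
        rw [add_mul, mul_assoc K₀]
        exact le_add_of_nonneg_left (by positivity)

lemma longRangeTerm_eq (α : ℝ) (L : Fin 3 → E3) (n : Fin 3 → ℤ) :
    longRangeTerm α L q R n = imageEnergy α 0 q R (latticeVec L n) := by
  simp [longRangeTerm, imageEnergy, dampedKernel, add_sub_right_comm]

lemma dampedEnergy_eq_tsum_imageEnergy (ke α κ : ℝ) (L : Fin 3 → E3) :
    dampedEnergy ke α κ L q R
      = ke / 2 * ∑' n : Fin 3 → ℤ, imageEnergy α κ q R (latticeVec L n) := by
  simp only [dampedEnergy, imageEnergy, dampedKernel, add_sub_right_comm]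

theorem summable_longRangeTerm (hq : ∑ i, q i = 0) (hR : ∑ i, q i • R i = 0) {α : ℝ}
    (hα : 0 ≤ α) {L : Fin 3 → E3} (hL : LinearIndependent ℝ L) :
    Summable fun n : Fin 3 → ℤ => longRangeTerm α L q R n := by
  obtain ⟨B, hB, hle⟩ := exists_summable_bound_imageEnergy hq hR hα hL
  refine Summable.of_norm_bounded hB fun n => ?_
  rw [longRangeTerm_eq]
  exact hle 0 le_rfl n

/-- For a neutral cell without dipole moment, the damped energies converge to the plain lattice
sum, by dominated convergence. -/
theorem tendsto_dampedEnergy_longRangeEnergy (hq : ∑ i, q i = 0) (hR : ∑ i, q i • R i = 0)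
    (ke : ℝ) {α : ℝ} (hα : 0 ≤ α) {L : Fin 3 → E3} (hL : LinearIndependent ℝ L) :
    Tendsto (fun κ : ℝ => dampedEnergy ke α κ L q R) (𝓝[>] 0)
      (𝓝 (longRangeEnergy ke α L q R)) := by
  obtain ⟨B, hB, hle⟩ := exists_summable_bound_imageEnergy hq hR hα hL
  simp only [dampedEnergy_eq_tsum_imageEnergy, longRangeEnergy, longRangeTerm_eq]
  refine Tendsto.const_mul _ (tendsto_tsum_of_dominated_convergence hB (fun n => ?_) ?_)
  · have : Continuous fun κ : ℝ => imageEnergy α κ q R (latticeVec L n) := by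
      unfold imageEnergy dampedKernel
      fun_prop
    exact this.continuousWithinAt
  · filter_upwards [self_mem_nhdsWithin] with κ hκ n
    exact hle κ (le_of_lt hκ) n

end Dipole

end Ewald

theorem mainTheorem2 (N : ℕ) (ke α : ℝ) (hα : 0 < α) (L : Fin 3 → E3)
    (hL : LinearIndependent ℝ L) (q : Fin N → ℝ) (R : Fin N → E3) :
    -- the damped lattice sum is an absolutely convergent, continuous, lattice-periodic function
    -- and is the sum of its Fourier series
    (∀ κ : ℝ, 0 < κ →
      (∀ r : E3, Summable (fun n : Fin 3 → ℤ => dampedTerm α κ L r n)) ∧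
      Continuous (dampedLattice α κ L) ∧
      (∀ (r : E3) (n : Fin 3 → ℤ),
        dampedLattice α κ L (r + latticeVec L n) = dampedLattice α κ L r) ∧
      (∀ r : E3, HasSum
        (fun m : Fin 3 → ℤ => cellFourierCoeff L (dampedLattice α κ L) m * planeWave L m r)
        (dampedLattice α κ L r : ℂ))) ∧
    -- its Fourier coefficients away from `m = 0` converge as the damping is removed
    (∀ m : Fin 3 → ℤ, m ≠ 0 →
      Tendsto (fun κ : ℝ => cellFourierCoeff L (dampedLattice α κ L) m) (𝓝[>] 0)
        (𝓝 (recipCoeff α L m : ℂ))) ∧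
    -- the lattice function without its mean is the reciprocal-lattice series
    (∀ r : E3,
      Summable (fun m : {m : Fin 3 → ℤ // m ≠ 0} => (recipCoeff α L m : ℂ) * planeWave L m r) ∧
      Tendsto (fun κ : ℝ => (dampedLattice α κ L r : ℂ) -
          cellFourierCoeff L (dampedLattice α κ L) 0) (𝓝[>] 0)
        (𝓝 (∑' m : {m : Fin 3 → ℤ // m ≠ 0}, (recipCoeff α L m : ℂ) * planeWave L m r))) ∧
    -- the long-range energy, with the zero mode removed, is the reciprocal-lattice series
    Summable (fun m : {m : Fin 3 → ℤ // m ≠ 0} => recipTerm ke α L q R m) ∧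
    Tendsto (fun κ : ℝ => (dampedEnergy ke α κ L q R : ℂ) -
        ((ke / 2 * (∑ i, q i) ^ 2 : ℝ) : ℂ) * cellFourierCoeff L (dampedLattice α κ L) 0)
      (𝓝[>] 0) (𝓝 (recipEnergy ke α L q R)) ∧
    -- for a neutral cell there is no zero mode
    (∑ i, q i = 0 →
      Tendsto (fun κ : ℝ => (dampedEnergy ke α κ L q R : ℂ)) (𝓝[>] 0)
        (𝓝 (recipEnergy ke α L q R))) ∧
    -- for a neutral cell without dipole moment the plain lattice sum converges absolutely, and no
    -- convergence factor is needed
    (∑ i, q i = 0 → ∑ i, q i • R i = 0 →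
      Summable (fun n : Fin 3 → ℤ => longRangeTerm α L q R n) ∧
      (longRangeEnergy ke α L q R : ℂ) = recipEnergy ke α L q R) := by
  refine ⟨fun κ hκ => ⟨fun r => summable_dampedKernel hα.le hκ hL r,
      continuous_dampedLattice hα.le hκ hL, dampedLattice_add_latticeVec α κ L,
      hasSum_dampedLattice hα.le hκ hL⟩,
    fun m hm => tendsto_cellFourierCoeff_dampedLattice hα hL hm,
    fun r => ⟨summable_recipCoeff_mul_planeWave hα hL r, tendsto_dampedLattice_sub hα hL r⟩,
    (hasSum_recipTerm ke q R hα hL).summable, tendsto_dampedEnergy_sub ke q R hα hL, ?_, ?_⟩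
  · intro hq
    simpa [hq] using tendsto_dampedEnergy_sub ke q R hα hL
  · intro hq hR
    refine ⟨summable_longRangeTerm hq hR hα.le hL, tendsto_nhds_unique
      ((Complex.continuous_ofReal.tendsto _).comp
        (tendsto_dampedEnergy_longRangeEnergy hq hR ke hα.le hL)) ?_⟩
    simpa [hq, Function.comp_def] using tendsto_dampedEnergy_sub ke q R hα hL
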